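/- Let $n\in\{1,2,\dots\}\cup\{\infty\}$, let $\mathbb F_n^+$ be the unital free semigroup on generators $g_i$ ($i=1,\dots,n$; $i\in\mathbb N$ if $n=\infty$) with identity $g_0$, and let $|\alpha|$ be the length of a word $\alpha$. For an $n$-tuple $X=(X_i)$ of bounded operators put $X_\alpha=X_{i_1}\cdots X_{i_k}$ if $\alpha=g_{i_1}\cdots g_{i_k}$, and $X_{g_0}=I$. Let $f=\sum_\alpha a_\alpha X_\alpha$ be a positive regular free holomorphic function, i.e. $a_\alpha\ge0$, $a_{g_0}=0$, $a_{g_i}>0$ for all $i$, and $\limsup_{k\to\infty}\bigl(\sum_{|\alpha|=k}|a_\alpha|^2\bigr)^{1/2k}<\infty$; let $m\ge1$ be an integer. Put $b_{g_0}=1$ and, for $|\alpha|\ge1$, $$b_\alpha=\sum_{j=1}^{|\alpha|}\ \sum_{\gamma_1\cdots\gamma_j=\alpha,\ |\gamma_i|\ge1}a_{\gamma_1}\cdots a_{\gamma_j}\binom{j+m-1}{m-1}.$$ On the full Fock space $F^2$ with orthonormal basis $\{e_\alpha\}_{\alpha\in\mathbb F_n^+}$ let $W_i$ be the bounded operators with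 $W_ie_\alpha=\sqrt{b_\alpha/b_{g_i\alpha}}\;e_{g_i\alpha}$. For a set $\mathcal P$ of noncommutative polynomials in $n$ indeterminates let $\mathcal M_{\mathcal P}$ be the closed linear span of $\{W_\alpha p(W)W_\beta e_{g_0}:\ p\in\mathcal P,\ \alpha,\beta\in\mathbb F_n^+\}$, let $\mathcal N_{\mathcal P}=F^2\ominus\mathcal M_{\mathcal P}$ and $B_i=P_{\mathcal N_{\mathcal P}}W_i|_{\mathcal N_{\mathcal P}}$. Assume $\mathcal N_{\mathcal P}\ne\{0\}$. Let $\mathcal H$ be a complex Hilbert space and $A=(A_i)$ an $n$-tuple in $B(\mathcal H)$ such that $\sum_{|\alpha|\ge1}a_\alpha A_\alpha A_\alpha^*$ converges in the strong operator topology and $p(A)=0$ for all $p\in\mathcal P$. Let $\Phi_{f,A}(Y)=\sum_{|\alpha|\ge1}a_\alpha A_\alpha YA_\alpha^*$ (weak operator topology), and let $C_{pure}(f,A)^+$ be the set of all $D\in B(\mathcal H)$ with $(id-\Phi_{f,A})^s(D)\ge0$ for $s=1,\dots,m$ and $\Phi_{f,A}^k(D)\to0$ strongly as $k\to\infty$.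 Let $\mathcal S$ be the $w^*$-closed linear span of $\{B_\alpha B_\beta^*:\alpha,\beta\in\mathbb F_n^+\}$ in $B(\mathcal N_{\mathcal P})$. Then: (i) The map $\varphi\mapsto\varphi(I)$ is a bijection from the set of all $w^*$-continuous completely positive linear maps $\varphi:\mathcal S\to B(\mathcal H)$ with $\varphi(B_\alpha B_\beta^*)=A_\alpha\varphi(I)A_\beta^*$ for all $\alpha,\beta\in\mathbb F_n^+$ onto $C_{pure}(f,A)^+$. (ii) Let $D\in C_{pure}(f,A)^+$, $R=(id-\Phi_{f,A})^m(D)$ and $\mathcal R=\overline{R^{1/2}\mathcal H}$. Then $R\ge0$, there is $b>0$ with $\sum_{k=0}^\infty\binom{k+m-1}{m-1}\Phi_{f,A}^k(R)\le bI$, the formula $Kh=\sum_\alpha\sqrt{b_\alpha}\,e_\alpha\otimes R^{1/2}A_\alpha^*h$ ($h\in\mathcal H$) defines a bounded operator $K:\mathcal H\to F^2\otimes\mathcal R$, and, with $K_q=(P_{\mathcal N_{\mathcal P}}\otimes I_{\mathcal R})K:\mathcal H\to\mathcal N_{\mathcal P}\otimes\mathcal R$, the inverse image of $D$ under the bijection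 in (i) is the Berezin transform $\chi\mapsto K_q^*(\chi\otimes I_{\mathcal R})K_q$, $\chi\in\mathcal S$. (iii) An operator $D\in B(\mathcal H)$ belongs to $C_{pure}(f,A)^+$ if and only if there are a Hilbert space $\mathcal D$ and a bounded operator $K:\mathcal H\to\mathcal N_{\mathcal P}\otimes\mathcal D$ such that $D=K^*K$ and $KA_i^*=(B_i^*\otimes I_{\mathcal D})K$ for all $i$. -/

import Mathlib

open scoped InnerProductSpace ENNReal Topology
open Filter ContinuousLinearMap

universe u

namespace NCVariety

/-! ### Words and operator tuples

The free semigroup on the generators `g_i`, `i : ι`, is `FreeMonoid ι`; an `n`-tuple of operators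
is a family `X : ι → E →L[ℂ] E`.  The index type `ι` is nonempty and countable, so that `n` is a
positive integer or `∞`. -/

section Words

variable {ι : Type*} {E : Type*} [NormedAddCommGroup E] [InnerProductSpace ℂ E]

/-- `X_α = X_{i₁} ⋯ X_{i_k}` for `α = g_{i₁} ⋯ g_{i_k}`, and `X_α = I` for the empty word. -/
noncomputable def word (X : ι → E →L[ℂ] E) (α : FreeMonoid ι) : E →L[ℂ] E :=
  FreeMonoid.lift X α

/-- The value `p(X)` of a noncommutative polynomial `p` at the tuple `X`. -/
noncomputable def evalPoly (X : ι → E →L[ℂ] E) (p : FreeAlgebra ℂ ι) : E →L[ℂ] E :=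
  FreeAlgebra.lift ℂ X p

end Words

/-- A positive regular free holomorphic function `f = ∑ a_α X_α` (given by its coefficients). -/
structure PositiveRegular (ι : Type*) where
  /-- the coefficient `a_α` -/
  coeff : FreeMonoid ι → ℝ
  coeff_nonneg : ∀ α, 0 ≤ coeff α
  coeff_one : coeff 1 = 0
  coeff_of_pos : ∀ i, 0 < coeff (FreeMonoid.of i)
  limsup_lt_top :
    limsup (fun k : ℕ =>
      (∑' α : {α : FreeMonoid ι // α.length = k}, ENNReal.ofReal (coeff α ^ 2)) ^
        (1 / (2 * (k : ℝ)))) atTop < ⊤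

/-! ### The Fock space -/

/-- The full Fock space, written as `ℓ²` over its canonical orthonormal basis `e_α`. -/
abbrev Fock (ι : Type*) : Type _ := lp (fun _ : FreeMonoid ι => ℂ) 2

section Fock

variable {ι : Type*}

open scoped Classical in
/-- The canonical basis vector `e_α`; `e_1` is the vacuum vector `1`. -/
noncomputable def basisVec (α : FreeMonoid ι) : Fock ι := lp.single 2 α (1 : ℂ)

theorem orthonormal_basisVec : Orthonormal ℂ (basisVec : FreeMonoid ι → Fock ι) := by
  classical
  rw [orthonormal_iff_ite]
  intro α β
  unfold basisVec
  rw [lp.inner_single_left, lp.single_apply]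
  by_cases h : α = β
  · subst h; simp
  · simp [h]

theorem orthonormal_basisVec_mul (i : ι) :
    Orthonormal ℂ (fun α : FreeMonoid ι => basisVec (FreeMonoid.of i * α)) :=
  orthonormal_basisVec.comp _ (mul_right_injective _)

/-- The left creation operator `S_i`, the isometry with `S_i e_α = e_i ⊗ e_α = e_{g_i α}`. -/
noncomputable def leftCreation (i : ι) : Fock ι →L[ℂ] Fock ι :=
  (orthonormal_basisVec_mul i).orthogonalFamily.linearIsometry.toContinuousLinearMap

theorem leftCreation_basisVec (i : ι) (α : FreeMonoid ι) :
    leftCreation i (basisVec α) = basisVec (FreeMonoid.of i * α) := by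
  classical
  have h := (orthonormal_basisVec_mul i).orthogonalFamily.linearIsometry_apply_single
    (i := α) (1 : ℂ)
  have h' : (orthonormal_basisVec_mul i).orthogonalFamily.linearIsometry (basisVec α)
      = basisVec (FreeMonoid.of i * α) := by
    have e : basisVec α = lp.single (E := fun _ : FreeMonoid ι => ℂ) 2 α (1 : ℂ) := by
      unfold basisVec; congr
    rw [e, h]
    simp [LinearIsometry.toSpanSingleton]
  exact h'

end Fock

namespace PositiveRegular

variable {ι : Type*} (f : PositiveRegular ι)

/-! ### The weights `b_α^{(m)}` -/

/-- `∑ a_{γ₁} ⋯ a_{γ_j}` over all factorizations `α = γ₁ ⋯ γ_j` into `j` nonempty words; the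
recursion splits off the first factor `γ₁`, a prefix of `α` of length `k + 1`. -/
noncomputable def factorSum : ℕ → FreeMonoid ι → ℝ
  | 0, α => if α.length = 0 then 1 else 0
  | j + 1, α => ∑ k ∈ Finset.range α.length,
      f.coeff (FreeMonoid.ofList (α.toList.take (k + 1))) *
        factorSum j (FreeMonoid.ofList (α.toList.drop (k + 1)))

/-- The weight `b_α^{(m)} = ∑_{j=1}^{|α|} ∑_{γ₁⋯γ_j=α} a_{γ₁}⋯a_{γ_j} * C(j+m-1, m-1)` for a
nonempty word `α`, and `b_α^{(m)} = 1` for the empty word (`m ≥ 1`). -/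
noncomputable def weight (m : ℕ) (α : FreeMonoid ι) : ℝ :=
  if α.length = 0 then 1 else
    ∑ j ∈ Finset.Icc 1 α.length, f.factorSum j α * ((j + m - 1).choose (m - 1) : ℝ)

theorem factorSum_nonneg (j : ℕ) (α : FreeMonoid ι) : 0 ≤ f.factorSum j α := by
  induction j generalizing α with
  | zero => unfold factorSum; split_ifs <;> norm_num
  | succ j ih =>
    unfold factorSum
    exact Finset.sum_nonneg fun k _ => mul_nonneg (f.coeff_nonneg _) (ih _)

theorem weight_eq_range (m : ℕ) (α : FreeMonoid ι) :
    f.weight m α = ∑ j ∈ Finset.range (α.length + 1),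
      f.factorSum j α * ((j + m - 1).choose (m - 1) : ℝ) := by
  unfold weight
  split_ifs with h
  · simp [h, factorSum]
  · rw [Finset.sum_range_succ']
    have h0 : f.factorSum 0 α = 0 := by unfold factorSum; simp [h]
    rw [h0, zero_mul, add_zero]
    rw [Finset.range_eq_Ico, Finset.sum_Ico_add' (fun j => f.factorSum j α *
      ((j + m - 1).choose (m - 1) : ℝ)) 0 α.length 1]
    rfl

theorem coeff_mul_factorSum_le (i : ι) (j : ℕ) (γ : FreeMonoid ι) :
    f.coeff (FreeMonoid.of i) * f.factorSum j γ
      ≤ f.factorSum (j + 1) (FreeMonoid.of i * γ) := by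
  have hlen : (FreeMonoid.of i * γ).length = γ.length + 1 := by
    rw [FreeMonoid.length_mul, FreeMonoid.length_of, add_comm]
  rw [show f.factorSum (j + 1) (FreeMonoid.of i * γ) = ∑ k ∈ Finset.range (γ.length + 1),
      f.coeff (FreeMonoid.ofList ((FreeMonoid.of i * γ).toList.take (k + 1))) *
        f.factorSum j (FreeMonoid.ofList ((FreeMonoid.of i * γ).toList.drop (k + 1))) from by
    rw [← hlen]; rfl]
  have h := Finset.single_le_sum (f := fun k =>
      f.coeff (FreeMonoid.ofList ((FreeMonoid.of i * γ).toList.take (k + 1))) *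
        f.factorSum j (FreeMonoid.ofList ((FreeMonoid.of i * γ).toList.drop (k + 1))))
      (s := Finset.range (γ.length + 1))
      (fun k _ => mul_nonneg (f.coeff_nonneg _) (f.factorSum_nonneg _ _))
      (Finset.mem_range.mpr (Nat.succ_pos γ.length))
  exact h

theorem coeff_mul_weight_le (m : ℕ) (i : ι) (γ : FreeMonoid ι) :
    f.coeff (FreeMonoid.of i) * f.weight m γ ≤ f.weight m (FreeMonoid.of i * γ) := by
  have hlen : (FreeMonoid.of i * γ).length = γ.length + 1 := by
    rw [FreeMonoid.length_mul, FreeMonoid.length_of, add_comm]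
  rw [weight_eq_range, weight_eq_range, hlen, Finset.sum_range_succ' _ (γ.length + 1),
    Finset.mul_sum]
  refine le_add_of_le_of_nonneg (Finset.sum_le_sum fun j _ => ?_)
    (mul_nonneg (f.factorSum_nonneg _ _) (Nat.cast_nonneg _))
  rw [← mul_assoc]
  refine mul_le_mul (f.coeff_mul_factorSum_le i j γ) ?_ (Nat.cast_nonneg _)
    (f.factorSum_nonneg _ _)
  exact_mod_cast Nat.choose_le_choose _ (by omega)

theorem weight_pos (m : ℕ) (α : FreeMonoid ι) : 0 < f.weight m α := by
  induction α using FreeMonoid.inductionOn' with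
  | one => simp [weight]
  | of_mul i γ ih =>
    exact lt_of_lt_of_le (mul_pos (f.coeff_of_pos i) ih) (f.coeff_mul_weight_le m i γ)

/-! ### The weighted left creation operators -/

theorem norm_ratio_le (m : ℕ) (i : ι) (α : FreeMonoid ι) :
    ‖((√(f.weight m α / f.weight m (FreeMonoid.of i * α)) : ℝ) : ℂ) • ContinuousLinearMap.id ℂ ℂ‖
      ≤ √(1 / f.coeff (FreeMonoid.of i)) := by
  rw [norm_smul, ContinuousLinearMap.norm_id, mul_one, Complex.norm_real, Real.norm_eq_abs,
    abs_of_nonneg (Real.sqrt_nonneg _)]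
  apply Real.sqrt_le_sqrt
  rw [div_le_div_iff₀ (f.weight_pos m _) (f.coeff_of_pos i), one_mul, mul_comm]
  exact f.coeff_mul_weight_le m i α

/-- The diagonal operator `D_i e_α = √(b_α / b_{g_i α}) e_α`. -/
noncomputable def diag (m : ℕ) (i : ι) : Fock ι →L[ℂ] Fock ι :=
  lp.mapCLM 2
    (fun α => ((√(f.weight m α / f.weight m (FreeMonoid.of i * α)) : ℝ) : ℂ) •
      ContinuousLinearMap.id ℂ ℂ)
    (Real.sqrt_nonneg (1 / f.coeff (FreeMonoid.of i))) (f.norm_ratio_le m i)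

/-- The weighted left creation operator `W_i = S_i D_i`. -/
noncomputable def shift (m : ℕ) (i : ι) : Fock ι →L[ℂ] Fock ι :=
  leftCreation i ∘L f.diag m i

theorem diag_basisVec (m : ℕ) (i : ι) (α : FreeMonoid ι) :
    f.diag m i (basisVec α) =
      ((√(f.weight m α / f.weight m (FreeMonoid.of i * α)) : ℝ) : ℂ) • basisVec α := by
  classical
  ext β
  rw [lp.coeFn_smul, Pi.smul_apply]
  by_cases h : β = α
  · subst h; simp [diag, basisVec]
  · simp [diag, basisVec, lp.single_apply, h]

theorem shift_basisVec (m : ℕ) (i : ι) (α : FreeMonoid ι) :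
    f.shift m i (basisVec α) =
      ((√(f.weight m α / f.weight m (FreeMonoid.of i * α)) : ℝ) : ℂ) •
        basisVec (FreeMonoid.of i * α) := by
  unfold shift
  rw [ContinuousLinearMap.comp_apply, diag_basisVec, map_smul, leftCreation_basisVec]

/-! ### The universal model of the noncommutative variety -/

/-- `M_P`, the closed span of the vectors `W_α p(W) W_β 1`, `p ∈ P`. -/
noncomputable def relSpace (m : ℕ) (P : Set (FreeAlgebra ℂ ι)) : Submodule ℂ (Fock ι) :=
  (Submodule.span ℂ {v | ∃ p ∈ P, ∃ α β : FreeMonoid ι,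
    v = word (f.shift m) α (evalPoly (f.shift m) p (word (f.shift m) β (basisVec 1)))}
  ).topologicalClosure

/-- `N_P`, the orthogonal complement of `M_P` in the Fock space. -/
noncomputable def modelSpace (m : ℕ) (P : Set (FreeAlgebra ℂ ι)) : Submodule ℂ (Fock ι) :=
  (f.relSpace m P)ᗮ

noncomputable instance instCompleteSpaceModelSpace (m : ℕ) (P : Set (FreeAlgebra ℂ ι)) :
    CompleteSpace (f.modelSpace m P) :=
  inferInstanceAs (CompleteSpace ((f.relSpace m P)ᗮ : Submodule ℂ (Fock ι)))

/-- `B_i = P_{N_P} W_i |_{N_P}`. -/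
noncomputable def model (m : ℕ) (P : Set (FreeAlgebra ℂ ι)) (i : ι) :
    f.modelSpace m P →L[ℂ] f.modelSpace m P :=
  (f.modelSpace m P).orthogonalProjectionOnto ∘L f.shift m i ∘L (f.modelSpace m P).subtypeL

end PositiveRegular

/-! ### The map `Φ_{f,X}` and the cone of pure solutions -/

section Cone

variable {ι : Type*} (f : PositiveRegular ι)
variable {E : Type*} [NormedAddCommGroup E] [InnerProductSpace ℂ E] [CompleteSpace E]

/-- `∑ a_α X_α X_α^*` converges in the strong operator topology (the terms are positive
operators, so the order of summation is immaterial). -/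
def SOTSummable (X : ι → E →L[ℂ] E) : Prop :=
  ∀ h : E, Summable fun α : FreeMonoid ι =>
    (f.coeff α : ℂ) • (word X α ∘L (word X α).adjoint) h

/-- `Φ_{f,X}(Y) = ∑ a_α X_α Y X_α^*`, the sum being taken in the weak operator topology. -/
noncomputable def Phi (X : ι → E →L[ℂ] E) (Y : E →L[ℂ] E) : E →L[ℂ] E :=
  ContinuousLinearMapWOT.toCLM
    (∑' α : FreeMonoid ι, (ContinuousLinearMapWOT.ofCLM
      ((f.coeff α : ℂ) • (word X α ∘L Y ∘L (word X α).adjoint)) : E →WOT[ℂ] E))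

/-- `(id - Φ_{f,X})^s (Y)`. -/
noncomputable def defect (X : ι → E →L[ℂ] E) (s : ℕ) (Y : E →L[ℂ] E) : E →L[ℂ] E :=
  (fun Z => Z - Phi f X Z)^[s] Y

/-- The cone `C_pure(f, A)^+`: all `D` with `(id - Φ_{f,A})^s (D) ≥ 0` for `s = 1, …, m` and
`Φ_{f,A}^k (D) → 0` strongly. -/
def pureCone (m : ℕ) (A : ι → E →L[ℂ] E) : Set (E →L[ℂ] E) :=
  {D | (∀ s, 1 ≤ s → s ≤ m → (defect f A s D).IsPositive) ∧
    ∀ h : E, Tendsto (fun k : ℕ => ((Phi f A)^[k] D) h) atTop (𝓝 0)}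

end Cone

/-! ### The `w^*`-topology of `B(E)` -/

section WeakStar

variable (E : Type*) [NormedAddCommGroup E] [InnerProductSpace ℂ E]

/-- The `w^*`-topology (ultraweak topology) of `B(E)`: the coarsest one for which all functionals
`T ↦ ∑ₙ ⟪yₙ, T xₙ⟫` with `∑ ‖xₙ‖² < ∞`, `∑ ‖yₙ‖² < ∞` are continuous. -/
@[reducible]
noncomputable def weakStar : TopologicalSpace (E →L[ℂ] E) :=
  TopologicalSpace.induced
    (fun (T : E →L[ℂ] E) (v : lp (fun _ : ℕ => E) 2 × lp (fun _ : ℕ => E) 2) =>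
      (∑' n, ⟪v.2 n, T (v.1 n)⟫_ℂ : ℂ)) Pi.topologicalSpace

theorem summable_weakStar (T : E →L[ℂ] E)
    (v : lp (fun _ : ℕ => E) 2 × lp (fun _ : ℕ => E) 2) :
    Summable fun n => ⟪v.2 n, T (v.1 n)⟫_ℂ :=
  lp.summable_inner v.2
    (lp.mapCLM (𝕜 := ℂ) 2 (fun _ : ℕ => T) (norm_nonneg T) (fun _ => le_rfl) v.1)

/-- The functionals defining the `w^*`-topology, as one linear map. -/
noncomputable def weakStarPairing :
    (E →L[ℂ] E) →ₗ[ℂ] (lp (fun _ : ℕ => E) 2 × lp (fun _ : ℕ => E) 2 → ℂ) where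
  toFun T v := ∑' n, ⟪v.2 n, T (v.1 n)⟫_ℂ
  map_add' S T := by
    ext v
    simp only [_root_.add_apply, inner_add_right, Pi.add_apply]
    exact (summable_weakStar E S v).tsum_add (summable_weakStar E T v)
  map_smul' c T := by
    ext v
    simp only [_root_.smul_apply, inner_smul_right, Pi.smul_apply, RingHom.id_apply,
      smul_eq_mul]
    exact tsum_mul_left

theorem weakStar_continuousAdd :
    @ContinuousAdd (E →L[ℂ] E) (weakStar E) _ :=
  continuousAdd_induced (weakStarPairing E)

theorem weakStar_continuousConstSMul :
    @ContinuousConstSMul ℂ (E →L[ℂ] E) (weakStar E) _ := by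
  let _ := weakStar E
  exact Topology.IsInducing.continuousConstSMul (f := id)
    (g := weakStarPairing E) ⟨rfl⟩ (by intro c x; exact (weakStarPairing E).map_smul c x)

variable {E}

/-- The `w^*`-closure of a linear subspace of `B(E)`. -/
noncomputable def weakStarClosure (S : Submodule ℂ (E →L[ℂ] E)) : Submodule ℂ (E →L[ℂ] E) :=
  letI := weakStar E
  haveI := weakStar_continuousAdd E
  haveI := weakStar_continuousConstSMul E
  S.topologicalClosure

theorem le_weakStarClosure (S : Submodule ℂ (E →L[ℂ] E)) : S ≤ weakStarClosure S := by
  let _ := weakStar E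
  have := weakStar_continuousAdd E
  have := weakStar_continuousConstSMul E
  exact S.le_topologicalClosure

end WeakStar

/-! ### Completely positive maps on spaces of operators -/

section CompletelyPositive

variable {E F : Type*} [NormedAddCommGroup E] [InnerProductSpace ℂ E]
  [NormedAddCommGroup F] [InnerProductSpace ℂ F]

open scoped ComplexOrder in
/-- The operator matrix `(M i j)` is a positive operator on `E ⊕ ⋯ ⊕ E` (`k` copies). -/
def MatrixPositive {k : ℕ} (M : Fin k → Fin k → E →L[ℂ] E) : Prop :=
  ∀ x : Fin k → E, 0 ≤ ∑ i, ∑ j, ⟪x i, M i j (x j)⟫_ℂ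

/-- Complete positivity of a linear map `φ : S → B(F)` on a subspace `S ⊆ B(E)`. -/
def IsCompletelyPositive {S : Submodule ℂ (E →L[ℂ] E)} (φ : S →ₗ[ℂ] (F →L[ℂ] F)) : Prop :=
  ∀ (k : ℕ) (M : Fin k → Fin k → S),
    MatrixPositive (fun i j => (M i j : E →L[ℂ] E)) → MatrixPositive (fun i j => φ (M i j))

end CompletelyPositive

section MapSet

variable {ι : Type*} (f : PositiveRegular ι) (m : ℕ) (P : Set (FreeAlgebra ℂ ι))

/-- The operator `B_α B_β^*` on `N_P`. -/
noncomputable def modelWord (α β : FreeMonoid ι) : f.modelSpace m P →L[ℂ] f.modelSpace m P :=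
  word (f.model m P) α ∘L (word (f.model m P) β).adjoint

/-- The operator space `S^{w*}_{f,P}`, the `w^*`-closed span of all `B_α B_β^*`. -/
noncomputable def opSystem : Submodule ℂ (f.modelSpace m P →L[ℂ] f.modelSpace m P) :=
  weakStarClosure (Submodule.span ℂ {T | ∃ α β : FreeMonoid ι, T = modelWord f m P α β})

theorem modelWord_mem (α β : FreeMonoid ι) : modelWord f m P α β ∈ opSystem f m P :=
  le_weakStarClosure _ (Submodule.subset_span ⟨α, β, rfl⟩)

theorem one_mem_opSystem :
    (1 : f.modelSpace m P →L[ℂ] f.modelSpace m P) ∈ opSystem f m P := by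
  have h := modelWord_mem f m P 1 1
  have e : modelWord f m P 1 1 = 1 := by
    unfold modelWord word
    rw [map_one]
    exact (congrArg (fun T => (1 : f.modelSpace m P →L[ℂ] f.modelSpace m P) ∘L T)
      (star_one (f.modelSpace m P →L[ℂ] f.modelSpace m P))).trans (mul_one _)
  rwa [e] at h

/-- The identity operator, as an element of `S^{w*}_{f,P}`. -/
noncomputable def opOne : opSystem f m P := ⟨1, one_mem_opSystem f m P⟩

/-- The operator `B_α B_β^*`, as an element of `S^{w*}_{f,P}`. -/
noncomputable def opWord (α β : FreeMonoid ι) : opSystem f m P :=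
  ⟨modelWord f m P α β, modelWord_mem f m P α β⟩

variable {H : Type*} [NormedAddCommGroup H] [InnerProductSpace ℂ H] [CompleteSpace H]

/-- The set `CP^{w*}(A, V^m_{f,P})`: all `w^*`-continuous completely positive linear maps
`φ : S^{w*}_{f,P} → B(H)` with `φ(B_α B_β^*) = A_α φ(I) A_β^*`. -/
def cpMaps (A : ι → H →L[ℂ] H) : Set (opSystem f m P →ₗ[ℂ] (H →L[ℂ] H)) :=
  {φ | IsCompletelyPositive φ ∧
    Continuous[(weakStar (f.modelSpace m P)).induced Subtype.val, weakStar H] φ ∧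
    ∀ α β : FreeMonoid ι,
      φ (opWord f m P α β) = word A α ∘L φ (opOne f m P) ∘L (word A β).adjoint}

end MapSet

/-! ### Hilbert space tensor products -/

/-- The Hilbert space tensor product: the completion of the algebraic tensor product for the
inner product with `⟪x ⊗ y, x' ⊗ y'⟫ = ⟪x, x'⟫ ⟪y, y'⟫`. -/
def HTensor (E F : Type*) [NormedAddCommGroup E] [InnerProductSpace ℂ E]
    [NormedAddCommGroup F] [InnerProductSpace ℂ F] : Type _ :=
  UniformSpace.Completion (TensorProduct ℂ E F)

section TensorInstances

variable (E F : Type*) [NormedAddCommGroup E] [InnerProductSpace ℂ E]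
    [NormedAddCommGroup F] [InnerProductSpace ℂ F]

noncomputable instance : NormedAddCommGroup (HTensor E F) :=
  inferInstanceAs (NormedAddCommGroup (UniformSpace.Completion (TensorProduct ℂ E F)))

noncomputable instance : InnerProductSpace ℂ (HTensor E F) :=
  inferInstanceAs (InnerProductSpace ℂ (UniformSpace.Completion (TensorProduct ℂ E F)))

noncomputable instance : CompleteSpace (HTensor E F) :=
  inferInstanceAs (CompleteSpace (UniformSpace.Completion (TensorProduct ℂ E F)))

end TensorInstances

section Tensor

variable {E E' : Type*} [NormedAddCommGroup E] [InnerProductSpace ℂ E]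
  [NormedAddCommGroup E'] [InnerProductSpace ℂ E']

/-- The elementary tensor `x ⊗ y`. -/
noncomputable def htmul {F : Type*} [NormedAddCommGroup F] [InnerProductSpace ℂ F]
    (x : E) (y : F) : HTensor E F :=
  (UniformSpace.Completion.coe' (TensorProduct.tmul ℂ x y) :
    UniformSpace.Completion (TensorProduct ℂ E F))

/-- The operator `T ⊗ I_F`. -/
noncomputable def tensorId (T : E →L[ℂ] E')
    (F : Type*) [NormedAddCommGroup F] [InnerProductSpace ℂ F] : HTensor E F →L[ℂ] HTensor E' F :=
  (T.rTensor F).completion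

theorem tensorId_htmul (T : E →L[ℂ] E') {F : Type*} [NormedAddCommGroup F]
    [InnerProductSpace ℂ F] (x : E) (y : F) :
    tensorId T F (htmul x y) = htmul (T x) y := by
  exact ContinuousLinearMap.completion_apply_coe (T.rTensor F) (TensorProduct.tmul ℂ x y)

end Tensor

/-! ### The Berezin kernel and the Berezin transform -/

section Berezin

variable {ι : Type*} (f : PositiveRegular ι) (m : ℕ)
variable {H : Type*} [NormedAddCommGroup H] [InnerProductSpace ℂ H] [CompleteSpace H]

/-- The tuple `q = (f, m, A, R, P)` is compatible: `∑ a_α A_α A_α^*` converges strongly, `R ≥ 0`,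
the series `∑_k C(k+m-1, m-1) Φ_{f,A}^k (R)` of positive operators is bounded by a multiple of
the identity, and `p(A) = 0` for `p ∈ P`. -/
def IsCompatible (A : ι → H →L[ℂ] H) (R : H →L[ℂ] H) (P : Set (FreeAlgebra ℂ ι)) : Prop :=
  SOTSummable f A ∧ R.IsPositive ∧
    (∃ b : ℝ, 0 < b ∧ ∀ N : ℕ,
      ((b : ℂ) • (1 : H →L[ℂ] H) - ∑ k ∈ Finset.range N,
        ((k + m - 1).choose (m - 1) : ℂ) • (Phi f A)^[k] R).IsPositive) ∧
    ∀ p ∈ P, evalPoly A p = 0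

/-- The closure of the range of `R^{1/2}`. -/
noncomputable def defectSpace (R : H →L[ℂ] H) : Submodule ℂ H :=
  (LinearMap.range (CFC.sqrt R).toLinearMap).topologicalClosure

noncomputable instance instCompleteSpaceDefectSpace (R : H →L[ℂ] H) :
    CompleteSpace (defectSpace R) :=
  (Submodule.isClosed_topologicalClosure _).completeSpace_coe

/-- `R^{1/2}` as an operator into the closure of its range. -/
noncomputable def sqrtInto (R : H →L[ℂ] H) : H →L[ℂ] defectSpace R :=
  (CFC.sqrt R).codRestrict (defectSpace R)
    fun h => Submodule.le_topologicalClosure _ ⟨h, rfl⟩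

/-- `K` is the Berezin kernel `K^{(m)}_{f,A,R}`, i.e. the bounded operator with
`K h = ∑_α √(b_α^{(m)}) e_α ⊗ R^{1/2} A_α^* h` for all `h`. -/
def IsBerezinKernel (A : ι → H →L[ℂ] H) (R : H →L[ℂ] H)
    (K : H →L[ℂ] HTensor (Fock ι) (defectSpace R)) : Prop :=
  ∀ h : H, HasSum (fun α : FreeMonoid ι =>
    ((√(f.weight m α) : ℝ) : ℂ) • htmul (basisVec α) (sqrtInto R ((word A α).adjoint h))) (K h)

/-- The constrained Berezin kernel `K_q = (P_{N_P} ⊗ I) K^{(m)}_{f,A,R}`. -/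
noncomputable def constrainedKernel (P : Set (FreeAlgebra ℂ ι)) {R : H →L[ℂ] H}
    (K : H →L[ℂ] HTensor (Fock ι) (defectSpace R)) :
    H →L[ℂ] HTensor (f.modelSpace m P) (defectSpace R) :=
  tensorId (f.modelSpace m P).orthogonalProjectionOnto (defectSpace R) ∘L K

/-- The transform `χ ↦ K^* (χ ⊗ I) K` on `B(N)` given by an operator `K : H → N ⊗ F`. -/
noncomputable def berezinTransform {N F : Type*} [NormedAddCommGroup N] [InnerProductSpace ℂ N]
    [NormedAddCommGroup F] [InnerProductSpace ℂ F]
    (K : H →L[ℂ] HTensor N F) (χ : N →L[ℂ] N) : H →L[ℂ] H :=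
  K.adjoint ∘L tensorId χ F ∘L K

end Berezin

end NCVariety

open NCVariety

/-! The weights `b_α` are the coefficients of the formal series `(1 - f)^{-m}`. If `D` lies in the
cone and `R = (id - Φ)^m(D)`, inverting `id - Φ` by its Neumann series `m` times gives `D = ∑ b_α
A_α R A_α^*`; purity, `Φ^k(D) → 0`, is what makes each of these series sum to the right operator.
Conversely, every positive operator with `⟪h, D h⟫ = ∑ b_α ‖T A_α^* h‖²` is in the cone: applying
`Φ` convolves the coefficients with those of `f`, so `id - Φ` lowers the exponent of `(1 - f)^{-t}`
and positivity survives. The cone is thus described by the predicate `IsForm`, which involves only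
series of nonnegative reals (`IsForm.mem_pureCone`, `isForm_of_mem_pureCone`).

From `D` to a map: the form of `D` says precisely that the Berezin kernel `K` is bounded with `K^* K
= D`. The weights of `W_i` are chosen so that `K A_i^* = (W_i^* ⊗ I) K`, and `p(A) = 0` then forces
`K` to take values in `N_P ⊗ R`. Compressing gives `K_q` intertwining `A_i^*` with `B_i^*`; slicing
along a basis of the second tensor factor shows that its Berezin transform is completely positive
and `w^*`-continuous.

From a map to `D`: Parseval's identity in `N_P` says that `I` itself is a form `∑ b_α B_α T^* T
B_α^*`, so `I` is in the cone of the model tuple `B`. An admissible `φ` satisfies `φ ∘ Φ_B = Φ_A ∘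
φ`, because the series for `Φ_B` converges in the `w^*`-topology; hence `φ` carries the defects and
the iterates of `I` to those of `φ(I)` (`cpMaps_mem_pureCone`). Injectivity is `w^*`-density of the
span of the `B_α B_β^*`. The factorization criterion (iii) is the same Parseval identity applied to
`K h` in the tensor product (`mem_pureCone_of_kernel`). -/

namespace NCVariety

/-! ### Nonnegative double series and factorizations of words -/

/-- Sums of nonnegative functions over a sigma type may be computed fiberwise. -/
theorem hasSum_sigma_iff_of_nonneg {I : Type*} {J : I → Type*} {F : (Σ i, J i) → ℝ}
    (hF : ∀ p, 0 ≤ F p) {S : I → ℝ} (hS : ∀ i, HasSum (fun j => F ⟨i, j⟩) (S i)) {s : ℝ} :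
    HasSum F s ↔ HasSum S s := by
  refine ⟨fun h => h.sigma hS, fun h => ?_⟩
  have hsum : Summable F := by
    rw [summable_sigma_of_nonneg hF]
    refine ⟨fun i => (hS i).summable, ?_⟩
    simpa only [(hS _).tsum_eq] using h.summable
  have := (hsum.hasSum.sigma hS).unique h
  exact this ▸ hsum.hasSum

/-- The factorizations `γ = α β` are given by the length of the prefix `α`. -/
def splitEquiv {ι : Type*} (γ : FreeMonoid ι) :
    Fin (γ.length + 1) ≃ {p : FreeMonoid ι × FreeMonoid ι // p.1 * p.2 = γ} where
  toFun k := ⟨(FreeMonoid.ofList (γ.toList.take k), FreeMonoid.ofList (γ.toList.drop k)),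
    List.take_append_drop _ _⟩
  invFun p := ⟨p.1.1.length, by
    have := congrArg FreeMonoid.length p.2
    rw [FreeMonoid.length_mul] at this
    omega⟩
  left_inv k := by
    ext
    have := k.2
    have h : (FreeMonoid.ofList (γ.toList.take k)).length = min (k : ℕ) γ.length := List.length_take
    simp only [h]
    omega
  right_inv := by
    rintro ⟨⟨α, β⟩, rfl⟩
    ext1
    have h1 : List.take α.toList.length (α.toList ++ β.toList) = α.toList := List.take_left
    have h2 : List.drop α.toList.length (α.toList ++ β.toList) = β.toList := List.drop_left
    exact Prod.ext h1 h2

/-! ### Formal series: convolution with `f` and the powers `(1 - f)^{-t}` -/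

namespace PositiveRegular

variable {ι : Type*} (f : PositiveRegular ι)

/-- Left convolution by the coefficients of `f`, i.e. the coefficients of `f · u`. -/
noncomputable def conv (u : FreeMonoid ι → ℝ) (α : FreeMonoid ι) : ℝ :=
  ∑ k ∈ Finset.range α.length,
    f.coeff (FreeMonoid.ofList (α.toList.take (k + 1))) *
      u (FreeMonoid.ofList (α.toList.drop (k + 1)))

/-- The coefficients of `(1 - f)^{-t}`. -/
noncomputable def powCoeff (t : ℕ) (α : FreeMonoid ι) : ℝ :=
  ∑ j ∈ Finset.range (α.length + 1), f.factorSum j α * (t.multichoose j : ℝ)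

theorem conv_factorSum (j : ℕ) : f.conv (f.factorSum j) = f.factorSum (j + 1) := rfl

/-- Passing from `C(j+m-1, m-1)` to `multichoose` makes Pascal's rule uniform in the exponent and
gives a meaning to exponent `0`, where the induction starts. -/
theorem weight_eq_powCoeff {m : ℕ} (hm : 1 ≤ m) : f.weight m = f.powCoeff m := by
  ext α
  rw [weight_eq_range, powCoeff]
  refine Finset.sum_congr rfl fun j _ => ?_
  rw [Nat.multichoose_eq, add_comm m j, ← Nat.choose_symm (by omega : j ≤ j + m - 1),
    show j + m - 1 - j = m - 1 by omega]

theorem length_drop (α : FreeMonoid ι) (k : ℕ) :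
    (FreeMonoid.ofList (α.toList.drop k)).length = α.length - k := List.length_drop

theorem conv_add (u v : FreeMonoid ι → ℝ) : f.conv (u + v) = f.conv u + f.conv v := by
  ext α
  simp [conv, mul_add, Finset.sum_add_distrib]

theorem conv_nonneg {u : FreeMonoid ι → ℝ} (hu : 0 ≤ u) : 0 ≤ f.conv u := fun _ =>
  Finset.sum_nonneg fun _ _ => mul_nonneg (f.coeff_nonneg _) (hu _)

theorem conv_mono {u v : FreeMonoid ι → ℝ} (h : u ≤ v) : f.conv u ≤ f.conv v := fun _ =>
  Finset.sum_le_sum fun _ _ => mul_le_mul_of_nonneg_left (h _) (f.coeff_nonneg _)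

theorem conv_iterate_add (k : ℕ) (u v : FreeMonoid ι → ℝ) :
    f.conv^[k] (u + v) = f.conv^[k] u + f.conv^[k] v := by
  induction k with
  | zero => rfl
  | succ k ih => simp only [Function.iterate_succ_apply', ih, conv_add]

theorem conv_iterate_nonneg (k : ℕ) {u : FreeMonoid ι → ℝ} (hu : 0 ≤ u) : 0 ≤ f.conv^[k] u := by
  induction k with
  | zero => exact hu
  | succ k ih => rw [Function.iterate_succ_apply']; exact f.conv_nonneg ih

theorem conv_iterate_le (k : ℕ) {u : FreeMonoid ι → ℝ} (hu : f.conv u ≤ u) :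
    f.conv^[k] u ≤ u := by
  induction k with
  | zero => exact le_rfl
  | succ k ih => rw [Function.iterate_succ_apply']; exact (f.conv_mono ih).trans hu

/-- Each convolution strips off a nonempty prefix, so a word with fewer than `k` letters runs out
before the `k`-th step. -/
theorem conv_iterate_eq_zero (k : ℕ) (u : FreeMonoid ι → ℝ) {α : FreeMonoid ι}
    (h : α.length < k) : f.conv^[k] u α = 0 := by
  induction k generalizing α with
  | zero => omega
  | succ k ih =>
    rw [Function.iterate_succ_apply']
    refine Finset.sum_eq_zero fun j hj => ?_
    rw [ih, mul_zero]
    have := Finset.mem_range.1 hj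
    rw [length_drop]
    omega

theorem factorSum_eq_iterate (j : ℕ) : f.factorSum j = f.conv^[j] (f.factorSum 0) := by
  induction j with
  | zero => rfl
  | succ j ih => rw [Function.iterate_succ_apply', ← ih, conv_factorSum]

theorem factorSum_eq_zero {j : ℕ} {α : FreeMonoid ι} (h : α.length < j) :
    f.factorSum j α = 0 := by
  rw [factorSum_eq_iterate, conv_iterate_eq_zero _ _ _ h]

theorem conv_powCoeff (t : ℕ) (α : FreeMonoid ι) :
    f.conv (f.powCoeff t) α =
      ∑ j ∈ Finset.range α.length, f.factorSum (j + 1) α * (t.multichoose j : ℝ) := by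
  have h : ∀ k ∈ Finset.range α.length,
      f.coeff (FreeMonoid.ofList (α.toList.take (k + 1))) *
        f.powCoeff t (FreeMonoid.ofList (α.toList.drop (k + 1))) =
      ∑ j ∈ Finset.range α.length, f.coeff (FreeMonoid.ofList (α.toList.take (k + 1))) *
        f.factorSum j (FreeMonoid.ofList (α.toList.drop (k + 1))) * (t.multichoose j : ℝ) := by
    intro k hk
    have hk := Finset.mem_range.1 hk
    rw [powCoeff, Finset.mul_sum]
    simp only [mul_assoc]
    -- The suffix is shorter than `α`, so the added terms have more factors than letters and vanish;
    -- a common range allows the sums to be interchanged.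
    refine Finset.sum_subset (Finset.range_mono ?_) fun j _ hj => ?_
    · rw [length_drop]; omega
    · rw [factorSum_eq_zero, zero_mul, mul_zero]
      simpa using hj
  rw [conv, Finset.sum_congr rfl h, Finset.sum_comm]
  refine Finset.sum_congr rfl fun j _ => ?_
  rw [← Finset.sum_mul]
  rfl

/-- This is `(1 - f)^{-(t+1)} = (1 - f)^{-t} + f (1 - f)^{-(t+1)}`, which on the level of
coefficients is Pascal's rule for `multichoose`. -/
theorem powCoeff_succ (t : ℕ) :
    f.powCoeff (t + 1) = f.powCoeff t + f.conv (f.powCoeff (t + 1)) := by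
  ext α
  rw [Pi.add_apply, conv_powCoeff, powCoeff, powCoeff, Finset.sum_range_succ',
    Finset.sum_range_succ', add_right_comm, ← Finset.sum_add_distrib]
  simp only [Nat.multichoose_zero_right, Nat.multichoose_succ_succ, Nat.cast_add, mul_add]

theorem powCoeff_zero : f.powCoeff 0 = f.factorSum 0 := by
  ext α
  rw [powCoeff, Finset.sum_range_succ']
  simp

theorem powCoeff_nonneg (t : ℕ) : 0 ≤ f.powCoeff t := fun _ =>
  Finset.sum_nonneg fun _ _ => mul_nonneg (f.factorSum_nonneg _ _) (Nat.cast_nonneg _)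

theorem conv_powCoeff_le (t : ℕ) : f.conv (f.powCoeff (t + 1)) ≤ f.powCoeff (t + 1) := by
  conv_rhs => rw [powCoeff_succ]
  exact le_add_of_nonneg_left (f.powCoeff_nonneg t)

theorem powCoeff_eq_sum_iterate (t N : ℕ) :
    f.powCoeff (t + 1) = ∑ k ∈ Finset.range N, f.conv^[k] (f.powCoeff t) +
      f.conv^[N] (f.powCoeff (t + 1)) := by
  induction N with
  | zero => simp
  | succ N ih =>
    have h : f.conv^[N] (f.powCoeff (t + 1)) =
        f.conv^[N] (f.powCoeff t) + f.conv^[N + 1] (f.powCoeff (t + 1)) := by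
      rw [Function.iterate_succ_apply, ← conv_iterate_add, ← powCoeff_succ]
    rw [Finset.sum_range_succ, add_assoc, ← h, ← ih]

/-- The Neumann series of `(1 - f)^{-1}` applied to `(1 - f)^{-t}`; at a fixed word only finitely
many terms are nonzero, so convergence is no issue. -/
theorem hasSum_conv_iterate (t : ℕ) (α : FreeMonoid ι) :
    HasSum (fun k => f.conv^[k] (f.powCoeff t) α) (f.powCoeff (t + 1) α) := by
  have h := congrFun (f.powCoeff_eq_sum_iterate t (α.length + 1)) α
  rw [Pi.add_apply, f.conv_iterate_eq_zero _ _ (Nat.lt_succ_self _), add_zero,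
    Finset.sum_apply] at h
  rw [h]
  refine hasSum_sum_of_ne_finset_zero fun k hk => f.conv_iterate_eq_zero _ _ ?_
  simpa using hk

theorem weight_one (m : ℕ) : f.weight m 1 = 1 := by simp [weight]

theorem sum_splitEquiv (u : FreeMonoid ι → ℝ) (γ : FreeMonoid ι) :
    ∑ k : Fin (γ.length + 1), f.coeff (splitEquiv γ k).1.1 * u (splitEquiv γ k).1.2 =
      f.conv u γ := by
  -- `conv` omits the empty prefix, which costs nothing because `f` has no constant term.
  have h0 : f.coeff (splitEquiv γ 0).1.1 = 0 := f.coeff_one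
  rw [Fin.sum_univ_succ, h0, zero_mul, zero_add, conv, Finset.sum_range]
  rfl

/-- The double sum `∑_α a_α ∑_β u_β g(αβ)` is `∑_γ (f · u)_γ g(γ)`. -/
theorem hasSum_conv_iff {u g G : FreeMonoid ι → ℝ} (hu : 0 ≤ u) (hg : 0 ≤ g)
    (hG : ∀ α, HasSum (fun β => u β * g (α * β)) (G α)) {s : ℝ} :
    HasSum (fun γ => f.conv u γ * g γ) s ↔ HasSum (fun α => f.coeff α * G α) s := by
  obtain ⟨F, hFdef⟩ : ∃ F : FreeMonoid ι × FreeMonoid ι → ℝ,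
      ∀ p, F p = f.coeff p.1 * (u p.2 * g (p.1 * p.2)) := ⟨_, fun _ => rfl⟩
  have hF : ∀ p, 0 ≤ F p := fun p => by
    rw [hFdef]
    exact mul_nonneg (f.coeff_nonneg _) (mul_nonneg (hu _) (hg _))
  -- The same nonnegative family on pairs `(α, β)` is summed in two ways: along fixed `α`, and along
  -- fixed product `γ = αβ`.
  have h1 : HasSum (F ∘ Equiv.sigmaEquivProd _ _) s ↔ HasSum (fun α => f.coeff α * G α) s := by
    refine hasSum_sigma_iff_of_nonneg (fun p => hF _) fun α => ?_
    simp only [Equiv.sigmaEquivProd_apply, hFdef]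
    exact (hG α).mul_left _
  have h2 : HasSum (F ∘ Equiv.sigmaFiberEquiv fun p : FreeMonoid ι × FreeMonoid ι => p.1 * p.2) s ↔
      HasSum (fun γ => f.conv u γ * g γ) s := by
    refine hasSum_sigma_iff_of_nonneg (fun p => hF _) fun γ => ?_
    rw [← (splitEquiv γ).hasSum_iff, ← sum_splitEquiv, Finset.sum_mul]
    have h := hasSum_fintype fun k : Fin (γ.length + 1) =>
      f.coeff (splitEquiv γ k).1.1 * u (splitEquiv γ k).1.2 * g γ
    refine (funext fun k => ?_ : _ = fun k : Fin (γ.length + 1) =>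
      f.coeff (splitEquiv γ k).1.1 * u (splitEquiv γ k).1.2 * g γ) ▸ h
    simp only [Function.comp_apply, Equiv.sigmaFiberEquiv_apply, hFdef, mul_assoc,
      (splitEquiv γ k).2]
  rw [← h1, ← h2, Equiv.hasSum_iff, Equiv.hasSum_iff]

end PositiveRegular

/-! ### Square summable families of operators and limits of positive operators -/

section Hilbert

variable {H F : Type*} [NormedAddCommGroup H] [InnerProductSpace ℂ H]
  [NormedAddCommGroup F] [InnerProductSpace ℂ F]

/-- A family of operators which is pointwise square summable is an operator into `ℓ²`. -/
theorem exists_lpOperator [CompleteSpace F] [CompleteSpace H] {I : Type*} (c : I → H →L[ℂ] F)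
    (hc : ∀ h, Summable fun i => ‖c i h‖ ^ 2) :
    ∃ T : H →L[ℂ] lp (fun _ : I => F) 2, ∀ h i, T h i = c i h := by
  have hmem : ∀ h, Memℓp (fun i => c i h) 2 := fun h => by
    refine memℓp_gen ?_
    simpa using hc h
  let T : H →ₗ[ℂ] lp (fun _ : I => F) 2 :=
    { toFun := fun h => ⟨fun i => c i h, hmem h⟩
      map_add' := fun x y => by ext i; exact map_add _ _ _
      map_smul' := fun r x => by ext i; exact map_smul _ _ _ }
  have hT : ∀ h i, T h i = c i h := fun _ _ => rfl
  refine ⟨⟨T, ?_⟩, hT⟩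
  -- No uniform bound is assumed: boundedness comes from the closed graph theorem, since the
  -- coordinates of `T` are continuous.
  refine T.continuous_of_seq_closed_graph fun u x y hu hTu => ?_
  ext i
  have h1 : Tendsto (fun n => T (u n) i) atTop (𝓝 (y i)) :=
    ((lp.evalCLM ℂ (fun _ : I => F) 2 i).continuous.tendsto y).comp hTu
  have h2 : Tendsto (fun n => T (u n) i) atTop (𝓝 (T x i)) := ((c i).continuous.tendsto x).comp hu
  exact tendsto_nhds_unique h1 h2

theorem exists_lpMap (I : Type*) (Y : F →L[ℂ] F) :
    ∃ M : lp (fun _ : I => F) 2 →L[ℂ] lp (fun _ : I => F) 2, ∀ v i, M v i = Y (v i) :=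
  ⟨lp.mapCLM 2 (fun _ : I => Y) (norm_nonneg Y) fun _ => le_rfl,
    fun v i => lp.mapCLM_apply_coe 2 (fun _ : I => Y) (norm_nonneg Y) (fun _ => le_rfl) v i⟩

theorem hasSum_norm_sq_lp {I : Type*} (v : lp (fun _ : I => F) 2) :
    HasSum (fun i => ‖v i‖ ^ 2) (‖v‖ ^ 2) := by
  have h := Complex.hasSum_re (lp.hasSum_inner (𝕜 := ℂ) v v)
  simpa [inner_self_eq_norm_sq_to_K, ← Complex.ofReal_pow] using h

/-- A square summable family of operators maps `ℓ²` sequences to `ℓ²` families. -/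
theorem memℓp_prod [CompleteSpace H] [CompleteSpace F] {I : Type*} (c : I → H →L[ℂ] F) (hc : ∀ h, Summable fun i => ‖c i h‖ ^ 2)
    (v : lp (fun _ : ℕ => H) 2) : Memℓp (fun p : ℕ × I => c p.2 (v p.1)) 2 := by
  obtain ⟨T, hT⟩ := exists_lpOperator c hc
  have h1 : ∀ n, HasSum (fun i => ‖c i (v n)‖ ^ 2) (‖T (v n)‖ ^ 2) := fun n => by
    have h := hasSum_norm_sq_lp (T (v n))
    have e : ∀ i, T (v n) i = c i (v n) := hT (v n)
    simpa only [e] using h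
  refine memℓp_gen ?_
  simp only [ENNReal.toReal_ofNat, Real.rpow_ofNat]
  refine (summable_prod_of_nonneg fun p => sq_nonneg _).2 ⟨fun n => (h1 n).summable, ?_⟩
  simp only [(h1 _).tsum_eq]
  refine Summable.of_nonneg_of_le (fun n => sq_nonneg _) (fun n => ?_)
    ((hasSum_norm_sq_lp v).summable.mul_left (‖T‖ ^ 2))
  rw [← mul_pow]
  exact pow_le_pow_left₀ (norm_nonneg _) (T.le_opNorm _) 2

theorem isPositive_of_re_inner_nonneg {T : H →L[ℂ] H} (hs : (T : H →ₗ[ℂ] H).IsSymmetric)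
    (h : ∀ x, 0 ≤ (⟪x, T x⟫_ℂ).re) : T.IsPositive :=
  ⟨hs, fun x => by
    rw [reApplyInnerSelf_apply, inner_re_symm]
    exact h x⟩

theorem re_inner_self_nonneg_of_isPositive {T : H →L[ℂ] H} (hT : T.IsPositive) (x : H) :
    0 ≤ (⟪x, T x⟫_ℂ).re := hT.re_inner_nonneg_right x

theorem inner_eq_re_of_isPositive {T : H →L[ℂ] H} (hT : T.IsPositive) (x : H) :
    ⟪x, T x⟫_ℂ = ((⟪x, T x⟫_ℂ).re : ℂ) := by
  have h := hT.isSymmetric x x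
  rw [ContinuousLinearMap.coe_coe, ← inner_conj_symm] at h
  exact (Complex.conj_eq_iff_re.1 h).symm

theorem isPositive_sub {S T : H →L[ℂ] H} (hS : S.IsPositive) (hT : T.IsPositive)
    (h : ∀ x, (⟪x, T x⟫_ℂ).re ≤ (⟪x, S x⟫_ℂ).re) : (S - T).IsPositive := by
  refine isPositive_of_re_inner_nonneg (hS.isSymmetric.sub hT.isSymmetric) fun x => ?_
  rw [sub_apply, inner_sub_right, Complex.sub_re]
  exact sub_nonneg.2 (h x)

theorem isPositive_of_tendsto {T : H →L[ℂ] H} {S : ℕ → H →L[ℂ] H} (hS : ∀ n, (S n).IsPositive)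
    (h : ∀ x, Tendsto (fun n => S n x) atTop (𝓝 (T x))) : T.IsPositive := by
  have hin : ∀ x y, Tendsto (fun n => ⟪y, S n x⟫_ℂ) atTop (𝓝 ⟪y, T x⟫_ℂ) := fun x y =>
    tendsto_const_nhds.inner (h x)
  have hin' : ∀ x y, Tendsto (fun n => ⟪S n x, y⟫_ℂ) atTop (𝓝 ⟪T x, y⟫_ℂ) := fun x y =>
    (h x).inner tendsto_const_nhds
  refine isPositive_of_re_inner_nonneg (fun x y => ?_) fun x => ?_
  · exact tendsto_nhds_unique (hin' x y) ((hin y x).congr fun n => ((hS n).isSymmetric x y).symm)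
  · exact ge_of_tendsto' ((Complex.continuous_re.tendsto _).comp (hin x x))
      fun n => re_inner_self_nonneg_of_isPositive (hS n) x

theorem isPositive_sqrt [CompleteSpace H] (R : H →L[ℂ] H) : (CFC.sqrt R).IsPositive :=
  (nonneg_iff_isPositive _).1 (CFC.sqrt_nonneg R)

theorem sqrt_apply_sqrt [CompleteSpace H] {R : H →L[ℂ] H} (hR : R.IsPositive) (h : H) :
    CFC.sqrt R (CFC.sqrt R h) = R h :=
  congrArg (fun T : H →L[ℂ] H => T h)
    (CFC.sqrt_mul_sqrt_self R ((nonneg_iff_isPositive R).2 hR))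

theorem norm_sq_sqrt [CompleteSpace H] {R : H →L[ℂ] H} (hR : R.IsPositive) (h : H) :
    ‖CFC.sqrt R h‖ ^ 2 = (⟪h, R h⟫_ℂ).re := by
  have := (isPositive_sqrt R).isSymmetric h (CFC.sqrt R h)
  rw [ContinuousLinearMap.coe_coe, sqrt_apply_sqrt hR] at this
  rw [← this]
  exact (inner_self_eq_norm_sq (𝕜 := ℂ) _).symm

/-- A sequence of positive operators which is bounded in the order and converges weakly to `0`
converges strongly to `0`. -/
theorem tendsto_zero_of_re_inner [CompleteSpace H] {D : H →L[ℂ] H} {Y : ℕ → H →L[ℂ] H}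
    (hY : ∀ k, (Y k).IsPositive) (hle : ∀ k h, (⟪h, Y k h⟫_ℂ).re ≤ (⟪h, D h⟫_ℂ).re)
    (hlim : ∀ h, Tendsto (fun k => (⟪h, Y k h⟫_ℂ).re) atTop (𝓝 0)) (h : H) :
    Tendsto (fun k => Y k h) atTop (𝓝 0) := by
  -- With `S = Y_k^{1/2}`: `‖Y_k h‖² = ⟪S h, Y_k S h⟫ ≤ ⟪S h, D S h⟫ ≤ ‖D‖ ‖S h‖² = ‖D‖ ⟪h, Y_k h⟫`.
  have hb : ∀ k, ‖Y k h‖ ^ 2 ≤ ‖D‖ * (⟪h, Y k h⟫_ℂ).re := fun k => by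
    have e : ‖Y k h‖ ^ 2 = (⟪CFC.sqrt (Y k) h, Y k (CFC.sqrt (Y k) h)⟫_ℂ).re := by
      rw [← norm_sq_sqrt (hY k), sqrt_apply_sqrt (hY k)]
    rw [e, ← norm_sq_sqrt (hY k) h]
    refine (hle k _).trans ?_
    refine (Complex.re_le_norm _).trans ((norm_inner_le_norm _ _).trans ?_)
    have := mul_le_mul_of_nonneg_left (D.le_opNorm (CFC.sqrt (Y k) h))
      (norm_nonneg (CFC.sqrt (Y k) h))
    nlinarith
  have hsq : Tendsto (fun k => ‖Y k h‖ ^ 2) atTop (𝓝 0) :=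
    squeeze_zero (fun _ => sq_nonneg _) hb (by simpa using (hlim h).const_mul ‖D‖)
  have := (Real.continuous_sqrt.tendsto _).comp hsq
  rw [tendsto_zero_iff_norm_tendsto_zero]
  simpa [Function.comp_def, Real.sqrt_sq] using this

end Hilbert

section Words

variable {ι : Type*} {E : Type*} [NormedAddCommGroup E] [InnerProductSpace ℂ E]

theorem word_one (X : ι → E →L[ℂ] E) : word X 1 = 1 := map_one _

theorem word_of (X : ι → E →L[ℂ] E) (i : ι) : word X (FreeMonoid.of i) = X i :=
  FreeMonoid.lift_eval_of _ _

theorem word_mul (X : ι → E →L[ℂ] E) (α β : FreeMonoid ι) :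
    word X (α * β) = word X α ∘L word X β := map_mul _ _ _

variable [CompleteSpace E]

theorem adjoint_word_mul (X : ι → E →L[ℂ] E) (α β : FreeMonoid ι) (h : E) :
    (word X (α * β)).adjoint h = (word X β).adjoint ((word X α).adjoint h) := by
  rw [word_mul, adjoint_comp]
  rfl

theorem adjoint_word_one (X : ι → E →L[ℂ] E) (h : E) : (word X 1).adjoint h = h := by
  rw [word_one]
  exact congrArg (fun T : E →L[ℂ] E => T h) (star_one (E →L[ℂ] E))

end Words

/-! ### The map `Φ_{f,X}` through its matrix coefficients -/

section PhiForm

variable {ι : Type*} (f : PositiveRegular ι)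
variable {E : Type*} [NormedAddCommGroup E] [InnerProductSpace ℂ E] [CompleteSpace E]

/-- The series `∑ a_α ‖X_α^* h‖²` converges for every `h`. -/
def FormBounded (X : ι → E →L[ℂ] E) : Prop :=
  ∀ h : E, Summable fun α : FreeMonoid ι => f.coeff α * ‖(word X α).adjoint h‖ ^ 2

variable {f}

/-- Pairing the strongly convergent series at `h` with `h` itself leaves this scalar series, the
only convergence needed to control `Φ`. -/
theorem SOTSummable.formBounded {X : ι → E →L[ℂ] E} (hX : SOTSummable f X) :
    FormBounded f X := fun h => by
  have h1 := ((innerSL ℂ h).summable (hX h)).hasSum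
  have h2 := (Complex.hasSum_re h1).summable
  convert h2 using 2 with α
  rw [innerSL_apply_apply, inner_smul_right, ContinuousLinearMap.comp_apply,
    ← adjoint_inner_left, inner_self_eq_norm_sq_to_K, Complex.re_ofReal_mul]
  norm_cast

theorem exists_coeffOperators {X : ι → E →L[ℂ] E} (hX : FormBounded f X) :
    ∃ c : FreeMonoid ι → E →L[ℂ] E,
      (∀ α h, c α h = ((√(f.coeff α) : ℝ) : ℂ) • (word X α).adjoint h) ∧
      ∀ h, Summable fun α => ‖c α h‖ ^ 2 := by
  refine ⟨fun α => ((√(f.coeff α) : ℝ) : ℂ) • (word X α).adjoint, fun _ _ => rfl, fun h => ?_⟩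
  refine (hX h).congr fun α => ?_
  rw [_root_.smul_apply, norm_smul, mul_pow, Complex.norm_real, Real.norm_eq_abs, sq_abs,
    Real.sq_sqrt (f.coeff_nonneg α)]

/-- The sum of the sesquilinear forms `a_α ⟪X_α^* y, Y X_α^* x⟫` is given by an operator. -/
theorem exists_operator_hasSum {X : ι → E →L[ℂ] E} (hX : FormBounded f X) (Y : E →L[ℂ] E) :
    ∃ Z : E →L[ℂ] E, ∀ x y, HasSum
      (fun α => (f.coeff α : ℂ) * ⟪(word X α).adjoint y, Y ((word X α).adjoint x)⟫_ℂ)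
      ⟪y, Z x⟫_ℂ := by
  obtain ⟨c, hcdef, hc⟩ := exists_coeffOperators hX
  obtain ⟨T, hT⟩ := exists_lpOperator c hc
  obtain ⟨M, hM⟩ := exists_lpMap (FreeMonoid ι) Y
  -- `T x = (√a_α X_α^* x)_α` and `M` applies `Y` in every coordinate, so `T^* M T` is the required
  -- sum.
  refine ⟨T.adjoint ∘L M ∘L T, fun x y => ?_⟩
  have h := lp.hasSum_inner (𝕜 := ℂ) (T y) (M (T x))
  rw [ContinuousLinearMap.comp_apply, ContinuousLinearMap.comp_apply, adjoint_inner_right]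
  have e : ∀ α, ⟪T y α, M (T x) α⟫_ℂ =
      (f.coeff α : ℂ) * ⟪(word X α).adjoint y, Y ((word X α).adjoint x)⟫_ℂ := fun α => by
    have h1 : T y α = c α y := hT y α
    have h2 : M (T x) α = Y (c α x) := (hM (T x) α).trans (congrArg Y (hT x α))
    rw [h1, h2, hcdef, hcdef, map_smul, inner_smul_left, inner_smul_right, Complex.conj_ofReal,
      ← mul_assoc, ← Complex.ofReal_mul, Real.mul_self_sqrt (f.coeff_nonneg α)]
  simpa only [e] using h

theorem hasSum_wot_iff {I : Type*} (T : I → E →L[ℂ] E) (Z : E →L[ℂ] E) :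
    HasSum (fun i => (ContinuousLinearMapWOT.ofCLM (T i) : E →WOT[ℂ] E))
      (ContinuousLinearMapWOT.ofCLM Z) ↔
    ∀ x y, HasSum (fun i => ⟪y, T i x⟫_ℂ) ⟪y, Z x⟫_ℂ := by
  have hs : ∀ (s : Finset I) (x y : E),
      ⟪y, (∑ i ∈ s, (ContinuousLinearMapWOT.ofCLM (T i) : E →WOT[ℂ] E)) x⟫_ℂ =
        ∑ i ∈ s, ⟪y, T i x⟫_ℂ := fun s x y => by
    induction s using Finset.cons_induction with
    | empty => simp
    | cons a s ha ih =>
      rw [Finset.sum_cons, Finset.sum_cons, ContinuousLinearMapWOT.add_apply, inner_add_right, ih,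
        ContinuousLinearMapWOT.ofCLM_apply]
  unfold HasSum
  simp only [ContinuousLinearMapWOT.tendsto_iff_forall_inner_apply_tendsto, hs,
    ContinuousLinearMapWOT.ofCLM_apply]

/-- An infinite sum in Lean is `0` by default when it diverges. The operator already constructed
from the forms certifies that the weak operator series converges, and afterwards `Φ` is used only
through this formula. -/
theorem hasSum_inner_Phi {X : ι → E →L[ℂ] E} (hX : FormBounded f X) (Y : E →L[ℂ] E) (x y : E) :
    HasSum (fun α => (f.coeff α : ℂ) * ⟪(word X α).adjoint y, Y ((word X α).adjoint x)⟫_ℂ)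
      ⟪y, Phi f X Y x⟫_ℂ := by
  obtain ⟨Z, hZ⟩ := exists_operator_hasSum hX Y
  have hsum : HasSum (fun α : FreeMonoid ι => (ContinuousLinearMapWOT.ofCLM
      ((f.coeff α : ℂ) • (word X α ∘L Y ∘L (word X α).adjoint)) : E →WOT[ℂ] E))
      (ContinuousLinearMapWOT.ofCLM Z) := by
    refine (hasSum_wot_iff _ _).2 fun x y => ?_
    have e : ∀ α, ⟪y, ((f.coeff α : ℂ) • (word X α ∘L Y ∘L (word X α).adjoint)) x⟫_ℂ =
        (f.coeff α : ℂ) * ⟪(word X α).adjoint y, Y ((word X α).adjoint x)⟫_ℂ := fun α => by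
      rw [_root_.smul_apply, inner_smul_right, adjoint_inner_left]
      rfl
    simpa only [e] using hZ x y
  have hPhi : Phi f X Y = Z := by
    unfold Phi
    rw [hsum.tsum_eq]
  rw [hPhi]
  exact hZ x y

theorem Phi_sub {X : ι → E →L[ℂ] E} (hX : FormBounded f X) (Y Z : E →L[ℂ] E) :
    Phi f X (Y - Z) = Phi f X Y - Phi f X Z := by
  ext x
  refine ext_inner_left ℂ fun y => ?_
  refine (hasSum_inner_Phi hX (Y - Z) x y).unique ?_
  rw [sub_apply, inner_sub_right]
  refine ((hasSum_inner_Phi hX Y x y).sub (hasSum_inner_Phi hX Z x y)).congr_fun ?_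
  intro α
  rw [sub_apply, inner_sub_right, mul_sub]

theorem Phi_iterate_sub {X : ι → E →L[ℂ] E} (hX : FormBounded f X) (k : ℕ) (Y Z : E →L[ℂ] E) :
    (Phi f X)^[k] (Y - Z) = (Phi f X)^[k] Y - (Phi f X)^[k] Z := by
  induction k with
  | zero => rfl
  | succ k ih => simp only [Function.iterate_succ_apply', ih, Phi_sub hX]

theorem hasSum_re_inner_Phi {X : ι → E →L[ℂ] E} (hX : FormBounded f X) (Y : E →L[ℂ] E) (h : E) :
    HasSum (fun α => f.coeff α * (⟪(word X α).adjoint h, Y ((word X α).adjoint h)⟫_ℂ).re)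
      (⟪h, Phi f X Y h⟫_ℂ).re := by
  simpa only [Complex.re_ofReal_mul] using Complex.hasSum_re (hasSum_inner_Phi hX Y h h)

theorem Phi_isPositive {X : ι → E →L[ℂ] E} (hX : FormBounded f X) {Y : E →L[ℂ] E}
    (hY : Y.IsPositive) : (Phi f X Y).IsPositive := by
  refine isPositive_of_re_inner_nonneg (fun y x => ?_) fun h =>
    (hasSum_re_inner_Phi hX Y h).nonneg fun α =>
      mul_nonneg (f.coeff_nonneg α) (re_inner_self_nonneg_of_isPositive hY _)
  rw [ContinuousLinearMap.coe_coe, ← inner_conj_symm]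
  refine HasSum.unique ?_ (hasSum_inner_Phi hX Y x y)
  have h := Complex.hasSum_conj'.2 (hasSum_inner_Phi hX Y y x)
  refine h.congr_fun fun α => ?_
  rw [map_mul, Complex.conj_ofReal, inner_conj_symm]
  congr 1
  exact (hY.isSymmetric _ _).symm

theorem Phi_iterate_isPositive {X : ι → E →L[ℂ] E} (hX : FormBounded f X) {Y : E →L[ℂ] E}
    (hY : Y.IsPositive) (k : ℕ) : ((Phi f X)^[k] Y).IsPositive := by
  induction k with
  | zero => exact hY
  | succ k ih => rw [Function.iterate_succ_apply']; exact Phi_isPositive hX ih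

theorem defect_succ (X : ι → E →L[ℂ] E) (s : ℕ) (D : E →L[ℂ] E) :
    defect f X (s + 1) D = defect f X s D - Phi f X (defect f X s D) :=
  Function.iterate_succ_apply' _ _ _

end PhiForm

/-! ### The cone of pure solutions as a set of weighted forms -/

section ConeForm

variable {ι : Type*} {f : PositiveRegular ι} {m : ℕ}
variable {E : Type*} [NormedAddCommGroup E] [InnerProductSpace ℂ E] [CompleteSpace E]
variable {F : Type*} [NormedAddCommGroup F] [InnerProductSpace ℂ F]

/-- `D` is the sum of the series `∑ u_α X_α T^* T X_α^*` in the sense of quadratic forms. -/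
def IsForm (X : ι → E →L[ℂ] E) (T : E →L[ℂ] F) (u : FreeMonoid ι → ℝ) (D : E →L[ℂ] E) : Prop :=
  D.IsPositive ∧
    ∀ h : E, HasSum (fun α => u α * ‖T ((word X α).adjoint h)‖ ^ 2) (⟪h, D h⟫_ℂ).re

variable {X : ι → E →L[ℂ] E} {T : E →L[ℂ] F}

/-- Since `X_{αβ}^* = X_β^* X_α^*`, the double series for `Φ(D)` regroups by the product word, and
the coefficients become a convolution. -/
theorem IsForm.phi (hX : FormBounded f X) {u : FreeMonoid ι → ℝ} (hu : 0 ≤ u) {D : E →L[ℂ] E}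
    (hD : IsForm X T u D) : IsForm X T (f.conv u) (Phi f X D) := by
  refine ⟨Phi_isPositive hX hD.1, fun h => ?_⟩
  refine (f.hasSum_conv_iff hu (g := fun α => ‖T ((word X α).adjoint h)‖ ^ 2)
    (fun α => sq_nonneg _) fun α => ?_).2 (hasSum_re_inner_Phi hX D h)
  simpa only [adjoint_word_mul] using hD.2 ((word X α).adjoint h)

theorem IsForm.phi_iterate (hX : FormBounded f X) {u : FreeMonoid ι → ℝ} (hu : 0 ≤ u)
    {D : E →L[ℂ] E} (hD : IsForm X T u D) (k : ℕ) :
    IsForm X T (f.conv^[k] u) ((Phi f X)^[k] D) := by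
  induction k with
  | zero => exact hD
  | succ k ih =>
    simp only [Function.iterate_succ_apply']
    exact ih.phi hX (f.conv_iterate_nonneg k hu)

/-- The coefficients of `(1 - f)(1 - f)^{-(t+1)} = (1 - f)^{-t}` are still nonnegative, so the
difference is again a positive operator. -/
theorem IsForm.sub_phi (hX : FormBounded f X) {t : ℕ} {D : E →L[ℂ] E}
    (hD : IsForm X T (f.powCoeff (t + 1)) D) : IsForm X T (f.powCoeff t) (D - Phi f X D) := by
  have hP := hD.phi hX (f.powCoeff_nonneg _)
  have hs : ∀ h, HasSum (fun α => f.powCoeff t α * ‖T ((word X α).adjoint h)‖ ^ 2)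
      (⟪h, (D - Phi f X D) h⟫_ℂ).re := fun h => by
    have h1 := (hD.2 h).sub (hP.2 h)
    have e : ∀ α, f.powCoeff (t + 1) α - f.conv (f.powCoeff (t + 1)) α = f.powCoeff t α :=
      fun α => sub_eq_of_eq_add (congrFun (f.powCoeff_succ t) α)
    simpa only [← sub_mul, e, sub_apply, inner_sub_right, Complex.sub_re] using h1
  refine ⟨isPositive_of_re_inner_nonneg (hD.1.isSymmetric.sub hP.1.isSymmetric) fun h => ?_, hs⟩
  exact (hs h).nonneg fun α => mul_nonneg (f.powCoeff_nonneg _ _) (sq_nonneg _)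

theorem IsForm.defect (hX : FormBounded f X) (s t : ℕ) {D : E →L[ℂ] E}
    (hD : IsForm X T (f.powCoeff (t + s)) D) :
    IsForm X T (f.powCoeff t) (defect f X s D) := by
  induction s generalizing t with
  | zero => exact hD
  | succ s ih =>
    rw [defect_succ]
    exact (ih (t + 1) (by rwa [add_assoc, add_comm 1 s])).sub_phi hX

/-- Operators of the form `∑ b_α X_α T^* T X_α^*` belong to the cone of pure solutions. -/
theorem IsForm.mem_pureCone (hm : 1 ≤ m) (hX : FormBounded f X) {D : E →L[ℂ] E}
    (hD : IsForm X T (f.weight m) D) : D ∈ pureCone f m X := by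
  rw [f.weight_eq_powCoeff hm] at hD
  obtain ⟨n, rfl⟩ : ∃ n, m = n + 1 := ⟨m - 1, by omega⟩
  refine ⟨fun s _ hs => ?_, fun h => ?_⟩
  · refine (IsForm.defect hX s (n + 1 - s) (T := T) ?_).1
    rwa [Nat.sub_add_cancel hs]
  have hk := hD.phi_iterate hX (f.powCoeff_nonneg _)
  have hle : ∀ k, f.conv^[k] (f.powCoeff (n + 1)) ≤ f.powCoeff (n + 1) := fun k =>
    f.conv_iterate_le k (f.conv_powCoeff_le n)
  refine tendsto_zero_of_re_inner (D := D) (fun k => (hk k).1) (fun k x => ?_) (fun x => ?_) h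
  · exact hasSum_le (fun α => mul_le_mul_of_nonneg_right (hle k α) (sq_nonneg _)) ((hk k).2 x)
      (hD.2 x)
  · have h0 : ∀ k, (⟪x, (Phi f X)^[k] D x⟫_ℂ).re =
        ∑' α, f.conv^[k] (f.powCoeff (n + 1)) α * ‖T ((word X α).adjoint x)‖ ^ 2 := fun k =>
      ((hk k).2 x).tsum_eq.symm
    simp only [h0]
    rw [← tsum_zero (α := ℝ) (β := FreeMonoid ι)]
    -- The coefficients of `f^k (1 - f)^{-m}` are dominated by those of `(1 - f)^{-m}` and vanish at
    -- each fixed word once `k` exceeds its length.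
    refine tendsto_tsum_of_dominated_convergence (hD.2 x).summable (fun α => ?_)
      (Eventually.of_forall fun k α => ?_)
    · refine tendsto_const_nhds.congr' ?_
      filter_upwards [eventually_gt_atTop α.length] with k hk
      rw [f.conv_iterate_eq_zero k _ hk, zero_mul]
    · rw [Real.norm_of_nonneg (mul_nonneg (f.conv_iterate_nonneg k (f.powCoeff_nonneg _) α)
        (sq_nonneg _))]
      exact mul_le_mul_of_nonneg_right (hle k α) (sq_nonneg _)

theorem sum_phi_iterate (hX : FormBounded f X) (D : E →L[ℂ] E) (N : ℕ) :
    ∑ k ∈ Finset.range N, (Phi f X)^[k] (D - Phi f X D) = D - (Phi f X)^[N] D := by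
  induction N with
  | zero => simp
  | succ N ih =>
    rw [Finset.sum_range_succ, ih, Phi_iterate_sub hX, ← Function.iterate_succ_apply]
    abel

/-- By telescoping, `D` is the strong limit of the positive operators `∑_{k<N} Φ^k(D - Φ(D)) = D -
Φ^N(D)`. -/
theorem isPositive_of_sub_phi (hX : FormBounded f X) {D : E →L[ℂ] E}
    (hD : (D - Phi f X D).IsPositive)
    (hlim : ∀ h : E, Tendsto (fun k : ℕ => ((Phi f X)^[k] D) h) atTop (𝓝 0)) : D.IsPositive := by
  refine isPositive_of_tendsto (S := fun N => D - (Phi f X)^[N] D) (fun N => ?_) fun x => ?_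
  · rw [← sum_phi_iterate hX]
    exact isPositive_sum _ fun k _ => Phi_iterate_isPositive hX hD k
  · simpa using (hlim x).const_sub (D x)

/-- Summing the series `D = ∑_k Φ^k (D - Φ(D))`. -/
theorem IsForm.of_sub_phi (hX : FormBounded f X) {t : ℕ} {D : E →L[ℂ] E}
    (hD : IsForm X T (f.powCoeff t) (D - Phi f X D))
    (hlim : ∀ h : E, Tendsto (fun k : ℕ => ((Phi f X)^[k] D) h) atTop (𝓝 0)) :
    IsForm X T (f.powCoeff (t + 1)) D := by
  refine ⟨isPositive_of_sub_phi hX hD.1 hlim, fun h => ?_⟩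
  have hk := hD.phi_iterate hX (f.powCoeff_nonneg _)
  have h1 : HasSum (fun k => (⟪h, (Phi f X)^[k] (D - Phi f X D) h⟫_ℂ).re) (⟪h, D h⟫_ℂ).re := by
    rw [hasSum_iff_tendsto_nat_of_nonneg fun k =>
      re_inner_self_nonneg_of_isPositive (hk k).1 h]
    have h2 : ∀ N, ∑ k ∈ Finset.range N, (⟪h, (Phi f X)^[k] (D - Phi f X D) h⟫_ℂ).re =
        (⟪h, D h - (Phi f X)^[N] D h⟫_ℂ).re := fun N => by
      rw [← sub_apply, ← sum_phi_iterate hX, ← Complex.re_sum, sum_apply, inner_sum]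
    simp only [h2]
    have h3 := (tendsto_const_nhds (x := h)).inner (𝕜 := ℂ) ((hlim h).const_sub (D h))
    rw [sub_zero] at h3
    exact (Complex.continuous_re.tendsto _).comp h3
  obtain ⟨Q, hQ⟩ : ∃ Q : ℕ × FreeMonoid ι → ℝ, ∀ p, Q p =
      f.conv^[p.1] (f.powCoeff t) p.2 * ‖T ((word X p.2).adjoint h)‖ ^ 2 := ⟨_, fun _ => rfl⟩
  have hQ0 : ∀ p, 0 ≤ Q p := fun p => by
    rw [hQ]
    exact mul_nonneg (f.conv_iterate_nonneg _ (f.powCoeff_nonneg _) _) (sq_nonneg _)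
  -- Summing `Q` over words first recovers `⟪h, D h⟫`; summing over `k` first produces the
  -- coefficients of `(1 - f)^{-(t+1)}`. Nonnegativity permits the exchange.
  have h4 : HasSum (Q ∘ Equiv.sigmaEquivProd _ _) (⟪h, D h⟫_ℂ).re := by
    refine (hasSum_sigma_iff_of_nonneg (fun p => hQ0 _) fun k => ?_).2 h1
    simp only [Equiv.sigmaEquivProd_apply, hQ]
    exact (hk k).2 h
  have h5 : HasSum ((Q ∘ Equiv.prodComm _ _) ∘ Equiv.sigmaEquivProd _ _) (⟪h, D h⟫_ℂ).re := by
    rw [Equiv.hasSum_iff, Equiv.hasSum_iff]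
    exact (Equiv.hasSum_iff _).1 h4
  refine (hasSum_sigma_iff_of_nonneg (fun p => hQ0 _) fun α => ?_).1 h5
  simp only [Equiv.sigmaEquivProd_apply, Equiv.prodComm_apply, Prod.swap, hQ]
  exact (f.hasSum_conv_iterate t α).mul_right _

/-- Purity passes to every defect: `Φ^k` of the next defect is the difference of two consecutive
terms of a null sequence. -/
theorem tendsto_phi_iterate_defect (hX : FormBounded f X) {D : E →L[ℂ] E}
    (hlim : ∀ h : E, Tendsto (fun k : ℕ => ((Phi f X)^[k] D) h) atTop (𝓝 0)) (s : ℕ) (h : E) :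
    Tendsto (fun k : ℕ => ((Phi f X)^[k] (defect f X s D)) h) atTop (𝓝 0) := by
  induction s with
  | zero => exact hlim h
  | succ s ih =>
    have h1 := ih.sub ((tendsto_add_atTop_iff_nat 1).2 ih)
    rw [sub_zero] at h1
    refine h1.congr fun k => ?_
    rw [defect_succ, Phi_iterate_sub hX, sub_apply, Function.iterate_succ_apply]

theorem isForm_zero {R : E →L[ℂ] E} (hR : R.IsPositive) (hT : ∀ h, ‖T h‖ ^ 2 = (⟪h, R h⟫_ℂ).re) :
    IsForm X T (f.powCoeff 0) R := by
  refine ⟨hR, fun h => ?_⟩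
  have h1 := hasSum_single (1 : FreeMonoid ι)
    (f := fun α => f.powCoeff 0 α * ‖T ((word X α).adjoint h)‖ ^ 2) fun α hα => by
      have h0 : α.length ≠ 0 := fun h0 => hα (FreeMonoid.length_eq_zero.1 h0)
      rw [f.powCoeff_zero, PositiveRegular.factorSum, if_neg h0, zero_mul]
  have h2 : f.powCoeff 0 1 = 1 := by
    rw [f.powCoeff_zero, PositiveRegular.factorSum, if_pos FreeMonoid.length_one]
  rw [h2, one_mul, adjoint_word_one, hT] at h1
  exact h1

/-- Every `D` in the cone of pure solutions is `∑ b_α X_α R X_α^*` with `R = (id - Φ)^m (D)`. -/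
theorem isForm_of_mem_pureCone (hm : 1 ≤ m) (hX : FormBounded f X) {D : E →L[ℂ] E}
    (hD : D ∈ pureCone f m X) (hT : ∀ h, ‖T h‖ ^ 2 = (⟪h, defect f X m D h⟫_ℂ).re) :
    IsForm X T (f.weight m) D := by
  -- Start from `R`, the form with exponent `0`, and undo one factor `id - Φ` at a time; each raises
  -- the exponent by one.
  have key : ∀ j ≤ m, IsForm X T (f.powCoeff j) (defect f X (m - j) D) := fun j => by
    induction j with
    | zero => exact fun _ => isForm_zero (hD.1 m hm le_rfl) hT
    | succ j ih =>
      intro hj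
      refine IsForm.of_sub_phi hX ?_ (tendsto_phi_iterate_defect hX hD.2 _)
      rw [← defect_succ, show m - (j + 1) + 1 = m - j by omega]
      exact ih (by omega)
  rw [f.weight_eq_powCoeff hm]
  simpa [defect] using key m le_rfl

open scoped ComplexOrder in
-- The `N`-th partial sum keeps only the factorizations into fewer than `N` factors in each `b_α`,
-- so its form is at most that of `D`.
theorem isCompatible_of_mem_pureCone (hm : 1 ≤ m) (hX : SOTSummable f X) {D : E →L[ℂ] E}
    (hD : D ∈ pureCone f m X) {P : Set (FreeAlgebra ℂ ι)} (hP : ∀ p ∈ P, evalPoly X p = 0) :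
    IsCompatible f m X (defect f X m D) P := by
  have hR : (defect f X m D).IsPositive := hD.1 m hm le_rfl
  have hF := hX.formBounded
  have hDf := isForm_of_mem_pureCone hm hF hD fun h => norm_sq_sqrt hR h
  -- `‖D‖` already bounds the sums; adding `1` makes the constant strictly positive when `D = 0`.
  refine ⟨hX, hR, ⟨‖D‖ + 1, by positivity, fun N => ?_⟩, hP⟩
  have hk := (isForm_zero (f := f) (X := X) hR fun h => norm_sq_sqrt hR h).phi_iterate hF
    (f.powCoeff_nonneg _)
  refine isPositive_sub (isPositive_one.smul_of_nonneg ?_)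
    (isPositive_sum _ fun k _ => ((hk k).1.smul_of_nonneg (Nat.cast_nonneg _))) fun x => ?_
  · exact Complex.zero_le_real.2 (by positivity)
  have h1 : (⟪x, (∑ k ∈ Finset.range N, ((k + m - 1).choose (m - 1) : ℂ) •
      (Phi f X)^[k] (defect f X m D)) x⟫_ℂ).re ≤ (⟪x, D x⟫_ℂ).re := by
    have h2 : HasSum (fun α => ∑ k ∈ Finset.range N, ((k + m - 1).choose (m - 1) : ℝ) *
        (f.factorSum k α * ‖CFC.sqrt (defect f X m D) ((word X α).adjoint x)‖ ^ 2))
        (⟪x, (∑ k ∈ Finset.range N, ((k + m - 1).choose (m - 1) : ℂ) •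
          (Phi f X)^[k] (defect f X m D)) x⟫_ℂ).re := by
      have e : (⟪x, (∑ k ∈ Finset.range N, ((k + m - 1).choose (m - 1) : ℂ) •
          (Phi f X)^[k] (defect f X m D)) x⟫_ℂ).re = ∑ k ∈ Finset.range N,
          ((k + m - 1).choose (m - 1) : ℝ) * (⟪x, (Phi f X)^[k] (defect f X m D) x⟫_ℂ).re := by
        rw [sum_apply, inner_sum, Complex.re_sum]
        refine Finset.sum_congr rfl fun k _ => ?_
        rw [_root_.smul_apply, inner_smul_right, ← Complex.ofReal_natCast, Complex.re_ofReal_mul]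
      rw [e]
      refine hasSum_sum fun k _ => HasSum.mul_left _ ?_
      have := (hk k).2 x
      rwa [f.powCoeff_zero, ← f.factorSum_eq_iterate] at this
    refine hasSum_le (fun α => ?_) h2 (hDf.2 x)
    simp only [← mul_assoc]
    rw [← Finset.sum_mul]
    refine mul_le_mul_of_nonneg_right ?_ (sq_nonneg _)
    rw [f.weight_eq_range]
    have h3 : ∀ k, 0 ≤ ((k + m - 1).choose (m - 1) : ℝ) * f.factorSum k α := fun k =>
      mul_nonneg (Nat.cast_nonneg _) (f.factorSum_nonneg _ _)
    -- `N` may lie on either side of `|α| + 1`, hence the maximum: enlarging the range only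
    -- increases the sum, and terms with more factors than letters vanish.
    calc ∑ k ∈ Finset.range N, ((k + m - 1).choose (m - 1) : ℝ) * f.factorSum k α
        ≤ ∑ k ∈ Finset.range (max N (α.length + 1)),
          ((k + m - 1).choose (m - 1) : ℝ) * f.factorSum k α :=
          Finset.sum_le_sum_of_subset_of_nonneg (Finset.range_mono (le_max_left _ _))
            fun k _ _ => h3 k
      _ = ∑ k ∈ Finset.range (α.length + 1),
          ((k + m - 1).choose (m - 1) : ℝ) * f.factorSum k α := by
          refine (Finset.sum_subset (Finset.range_mono (le_max_right _ _)) fun k _ hk => ?_).symm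
          rw [f.factorSum_eq_zero (by simpa using hk), mul_zero]
      _ = _ := Finset.sum_congr rfl fun k _ => mul_comm _ _
  refine h1.trans ((Complex.re_le_norm _).trans ((norm_inner_le_norm _ _).trans ?_))
  rw [_root_.smul_apply, inner_smul_right, Complex.re_ofReal_mul,
    show (1 : E →L[ℂ] E) x = x from rfl]
  have h4 : (⟪x, x⟫_ℂ).re = ‖x‖ ^ 2 := inner_self_eq_norm_sq (𝕜 := ℂ) x
  rw [h4]
  have := mul_le_mul_of_nonneg_left (D.le_opNorm x) (norm_nonneg x)
  nlinarith [sq_nonneg ‖x‖]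

end ConeForm

/-! ### Hilbert tensor products and their slices -/

section HilbertSums

variable {I : Type*} {G K : Type*} [NormedAddCommGroup G] [InnerProductSpace ℂ G]
  [CompleteSpace G] [NormedAddCommGroup K] [InnerProductSpace ℂ K] [CompleteSpace K]

/-- Parseval's identity for a total orthogonal family of isometries. -/
theorem hasSum_inner_adjoint {V : I → G →ₗᵢ[ℂ] K} (hV : OrthogonalFamily ℂ (fun _ : I => G) V)
    (ht : ∀ z, (∀ i, (V i).toContinuousLinearMap.adjoint z = 0) → z = 0) (z z' : K) :
    HasSum (fun i => ⟪(V i).toContinuousLinearMap.adjoint z,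
      (V i).toContinuousLinearMap.adjoint z'⟫_ℂ) ⟪z, z'⟫_ℂ := by
  have hH : IsHilbertSum ℂ (fun _ : I => G) V := by
    refine IsHilbertSum.mk hV ?_
    rw [top_le_iff, Submodule.topologicalClosure_eq_top_iff, Submodule.eq_bot_iff]
    intro x hx
    refine ht x fun i => ext_inner_left ℂ fun g => ?_
    rw [adjoint_inner_right, inner_zero_right]
    exact (Submodule.mem_orthogonal _ _).1 hx _
      (Submodule.mem_iSup_of_mem i (LinearMap.mem_range_self _ g))
  have he : ∀ x i, hH.linearIsometryEquiv x i = (V i).toContinuousLinearMap.adjoint x := by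
    classical
    intro x i
    refine ext_inner_left ℂ fun g => ?_
    rw [adjoint_inner_right, ← lp.inner_single_left (𝕜 := ℂ) (G := fun _ : I => G) i g,
      ← hH.linearIsometryEquiv.symm.inner_map_map, hH.linearIsometryEquiv.symm_apply_apply,
      hH.linearIsometryEquiv_symm_apply_single]
    rfl
  have h := lp.hasSum_inner (𝕜 := ℂ) (hH.linearIsometryEquiv z) (hH.linearIsometryEquiv z')
  rw [hH.linearIsometryEquiv.inner_map_map] at h
  simpa only [he] using h

end HilbertSums

section HTensorLemmas

variable {E E' E'' F : Type*} [NormedAddCommGroup E] [InnerProductSpace ℂ E]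
  [NormedAddCommGroup E'] [InnerProductSpace ℂ E']
  [NormedAddCommGroup E''] [InnerProductSpace ℂ E'']
  [NormedAddCommGroup F] [InnerProductSpace ℂ F]

theorem inner_htmul (x x' : E) (y y' : F) :
    ⟪htmul x y, htmul x' y'⟫_ℂ = ⟪x, x'⟫_ℂ * ⟪y, y'⟫_ℂ :=
  (UniformSpace.Completion.inner_coe _ _).trans (TensorProduct.inner_tmul ..)

/-- The operator `x ↦ x ⊗ y`. -/
noncomputable def tensorRight (y : F) : E →L[ℂ] HTensor E F :=
  (UniformSpace.Completion.toComplL :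
    TensorProduct ℂ E F →L[ℂ] UniformSpace.Completion (TensorProduct ℂ E F)) ∘L
      (TensorProduct.mkL ℂ E F).flip y

/-- The operator `y ↦ x ⊗ y`. -/
noncomputable def tensorLeft (x : E) : F →L[ℂ] HTensor E F :=
  (UniformSpace.Completion.toComplL :
    TensorProduct ℂ E F →L[ℂ] UniformSpace.Completion (TensorProduct ℂ E F)) ∘L
      TensorProduct.mkL ℂ E F x

theorem tensorRight_apply (x : E) (y : F) : tensorRight y x = htmul x y := rfl

theorem tensorLeft_apply (x : E) (y : F) : tensorLeft x y = htmul x y := rfl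

theorem htmul_smul (c : ℂ) (x : E) (y : F) : htmul (c • x) y = c • htmul x y :=
  map_smul (tensorRight y) c x

theorem HTensor.ext_clm {G : Type*} [NormedAddCommGroup G] [NormedSpace ℂ G]
    {S T : HTensor E F →L[ℂ] G} (h : ∀ x y, S (htmul x y) = T (htmul x y)) : S = T := by
  ext z
  refine UniformSpace.Completion.induction_on (p := fun z : HTensor E F => S z = T z) z
    (isClosed_eq S.continuous T.continuous) fun t => ?_
  let j : TensorProduct ℂ E F →L[ℂ] HTensor E F := UniformSpace.Completion.toComplL
  have hj : S.toLinearMap ∘ₗ j.toLinearMap = T.toLinearMap ∘ₗ j.toLinearMap :=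
    TensorProduct.ext' fun x y => h x y
  exact LinearMap.congr_fun hj t

theorem HTensor.ext_inner {z z' : HTensor E F} (h : ∀ x y, ⟪htmul x y, z⟫_ℂ = ⟪htmul x y, z'⟫_ℂ) :
    z = z' := by
  have e : innerSL ℂ z = innerSL ℂ z' := HTensor.ext_clm fun x y => by
    rw [innerSL_apply_apply, innerSL_apply_apply, ← inner_conj_symm, h, inner_conj_symm]
  refine ext_inner_right ℂ fun w => ?_
  exact congrArg (fun S : HTensor E F →L[ℂ] ℂ => S w) e

theorem tensorId_comp (S : E' →L[ℂ] E'') (T : E →L[ℂ] E') :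
    tensorId (S ∘L T) F = tensorId S F ∘L tensorId T F :=
  HTensor.ext_clm fun x y => by
    rw [ContinuousLinearMap.comp_apply, tensorId_htmul, tensorId_htmul, tensorId_htmul,
      ContinuousLinearMap.comp_apply]

theorem tensorId_add (S T : E →L[ℂ] E') :
    tensorId (S + T) F = tensorId S F + tensorId T F :=
  HTensor.ext_clm fun x y => by
    rw [_root_.add_apply, tensorId_htmul, tensorId_htmul, tensorId_htmul, _root_.add_apply]
    exact map_add (tensorRight y) _ _

theorem tensorId_smul (c : ℂ) (T : E →L[ℂ] E') :
    tensorId (c • T) F = c • tensorId T F :=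
  HTensor.ext_clm fun x y => by
    rw [_root_.smul_apply, tensorId_htmul, tensorId_htmul, _root_.smul_apply]
    exact map_smul (tensorRight y) _ _

theorem tensorId_one : tensorId (1 : E →L[ℂ] E) F = 1 :=
  HTensor.ext_clm fun x y => by
    rw [tensorId_htmul]
    rfl

theorem adjoint_tensorId [CompleteSpace E] [CompleteSpace E'] (T : E →L[ℂ] E') :
    (tensorId T F).adjoint = tensorId T.adjoint F :=
  HTensor.ext_clm fun x y => HTensor.ext_inner fun x' y' => by
    rw [adjoint_inner_right, tensorId_htmul, tensorId_htmul, inner_htmul, inner_htmul,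
      adjoint_inner_right]

/-- The adjoint of `x ↦ x ⊗ y` is the slice map at `y`. Slices in the second factor commute with
operators on the first, which reduces statements on `E ⊗ F` to statements on `E`. -/
theorem adjoint_tensorRight_tensorId [CompleteSpace E] [CompleteSpace E'] (T : E →L[ℂ] E') (y : F)
    (z : HTensor E F) :
    (tensorRight y).adjoint (tensorId T F z) = T ((tensorRight y).adjoint z) := by
  refine ext_inner_left ℂ fun x => ?_
  rw [adjoint_inner_right, tensorRight_apply, ← adjoint_inner_left, adjoint_tensorId,
    tensorId_htmul, ← tensorRight_apply, ← adjoint_inner_right, adjoint_inner_left]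

theorem adjoint_tensorLeft_tensorId [CompleteSpace E] [CompleteSpace E'] [CompleteSpace F]
    (T : E →L[ℂ] E') (x : E') (z : HTensor E F) :
    (tensorLeft x).adjoint (tensorId T F z) = (tensorLeft (T.adjoint x)).adjoint z := by
  refine ext_inner_left ℂ fun y => ?_
  rw [adjoint_inner_right, adjoint_inner_right, tensorLeft_apply, ← adjoint_inner_left,
    adjoint_tensorId, tensorId_htmul, tensorLeft_apply]

theorem adjoint_tensorLeft_htmul [CompleteSpace F] (x x' : E) (y : F) :
    (tensorLeft x).adjoint (htmul x' y) = ⟪x, x'⟫_ℂ • y := by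
  refine ext_inner_left ℂ fun y' => ?_
  rw [adjoint_inner_right, tensorLeft_apply, inner_htmul, inner_smul_right]

theorem norm_htmul (x : E) (y : F) : ‖htmul x y‖ = ‖x‖ * ‖y‖ :=
  (UniformSpace.Completion.norm_coe _).trans (TensorProduct.norm_tmul ..)

/-- `x ↦ x ⊗ y` as an isometry, for a unit vector `y`. -/
noncomputable def tensorRightₗᵢ (y : F) (hy : ‖y‖ = 1) : E →ₗᵢ[ℂ] HTensor E F :=
  ⟨(tensorRight y).toLinearMap, fun x => (norm_htmul x y).trans (by rw [hy, mul_one])⟩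

/-- `y ↦ x ⊗ y` as an isometry, for a unit vector `x`. -/
noncomputable def tensorLeftₗᵢ (x : E) (hx : ‖x‖ = 1) : F →ₗᵢ[ℂ] HTensor E F :=
  ⟨(tensorLeft x).toLinearMap, fun y => (norm_htmul x y).trans (by rw [hx, one_mul])⟩

theorem orthogonalFamily_tensorLeft {I : Type*} {e : I → E} (he : Orthonormal ℂ e) :
    OrthogonalFamily ℂ (fun _ : I => F) fun i => tensorLeftₗᵢ (e i) (he.1 i) := by
  intro i j hij y y'
  exact (inner_htmul _ _ _ _).trans (by rw [he.2 hij, zero_mul])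

theorem orthogonalFamily_tensorRight {I : Type*} {e : I → F} (he : Orthonormal ℂ e) :
    OrthogonalFamily ℂ (fun _ : I => E) fun i => tensorRightₗᵢ (e i) (he.1 i) := by
  intro i j hij y y'
  exact (inner_htmul _ _ _ _).trans (by rw [he.2 hij, mul_zero])

theorem hasSum_inner_adjoint_tensorRight [CompleteSpace E] {I : Type*} (b : HilbertBasis I ℂ F)
    (z z' : HTensor E F) :
    HasSum (fun i => ⟪(tensorRight (b i)).adjoint z, (tensorRight (b i)).adjoint z'⟫_ℂ)
      ⟪z, z'⟫_ℂ := by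
  refine hasSum_inner_adjoint (orthogonalFamily_tensorRight (E := E) b.orthonormal)
    (fun z hz => ?_) z z'
  refine HTensor.ext_inner fun x y => ?_
  -- A vector with all slices zero is orthogonal to every `x ⊗ b_i`, hence by density of the span of
  -- the basis to every `x ⊗ y`.
  have h : (innerSL ℂ z ∘L tensorLeft x : F →L[ℂ] ℂ) = 0 := by
    refine ContinuousLinearMap.ext_on (s := Set.range b)
      (Submodule.dense_iff_topologicalClosure_eq_top.2 b.dense_span) ?_
    rintro _ ⟨i, rfl⟩
    have h1 : ⟪x, (tensorRight (b i)).adjoint z⟫_ℂ = 0 :=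
      (congrArg (fun w => ⟪x, w⟫_ℂ) (hz i)).trans (inner_zero_right _)
    rw [adjoint_inner_right, tensorRight_apply] at h1
    rw [ContinuousLinearMap.comp_apply, tensorLeft_apply, innerSL_apply_apply, ← inner_conj_symm,
      h1, map_zero, _root_.zero_apply]
  have h2 : ⟪z, htmul x y⟫_ℂ = 0 := congrArg (fun S : F →L[ℂ] ℂ => S y) h
  rw [← inner_conj_symm, h2, map_zero, inner_zero_right]

theorem hasSum_inner_adjoint_tensorLeft [CompleteSpace F] {I : Type*} (b : HilbertBasis I ℂ E)
    (z z' : HTensor E F) :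
    HasSum (fun i => ⟪(tensorLeft (b i)).adjoint z, (tensorLeft (b i)).adjoint z'⟫_ℂ)
      ⟪z, z'⟫_ℂ := by
  refine hasSum_inner_adjoint (orthogonalFamily_tensorLeft (F := F) b.orthonormal)
    (fun z hz => ?_) z z'
  refine HTensor.ext_inner fun x y => ?_
  have h : (innerSL ℂ z ∘L tensorRight y : E →L[ℂ] ℂ) = 0 := by
    refine ContinuousLinearMap.ext_on (s := Set.range b)
      (Submodule.dense_iff_topologicalClosure_eq_top.2 b.dense_span) ?_
    rintro _ ⟨i, rfl⟩
    have h1 : ⟪y, (tensorLeft (b i)).adjoint z⟫_ℂ = 0 :=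
      (congrArg (fun w => ⟪y, w⟫_ℂ) (hz i)).trans (inner_zero_right _)
    rw [adjoint_inner_right, tensorLeft_apply] at h1
    rw [ContinuousLinearMap.comp_apply, tensorRight_apply, innerSL_apply_apply, ← inner_conj_symm,
      h1, map_zero, _root_.zero_apply]
  have h2 : ⟪z, htmul x y⟫_ℂ = 0 := congrArg (fun S : E →L[ℂ] ℂ => S x) h
  rw [← inner_conj_symm, h2, map_zero, inner_zero_right]

end HTensorLemmas

/-! ### Complete positivity and `w^*`-continuity of the Berezin transform -/

section BerezinTransform

variable {N F H : Type*} [NormedAddCommGroup N] [InnerProductSpace ℂ N]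
  [NormedAddCommGroup F] [InnerProductSpace ℂ F]
  [NormedAddCommGroup H] [InnerProductSpace ℂ H] [CompleteSpace H]

theorem berezinTransform_add (K : H →L[ℂ] HTensor N F) (S T : N →L[ℂ] N) :
    berezinTransform K (S + T) = berezinTransform K S + berezinTransform K T := by
  rw [berezinTransform, tensorId_add, add_comp, comp_add]
  rfl

theorem berezinTransform_smul (K : H →L[ℂ] HTensor N F) (c : ℂ) (T : N →L[ℂ] N) :
    berezinTransform K (c • T) = c • berezinTransform K T := by
  rw [berezinTransform, tensorId_smul, smul_comp, comp_smul]
  rfl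

/-- The transform `χ ↦ K^* (χ ⊗ I) K` as a linear map on a subspace of `B(N)`. -/
noncomputable def berezinMap (K : H →L[ℂ] HTensor N F) (S : Submodule ℂ (N →L[ℂ] N)) :
    S →ₗ[ℂ] (H →L[ℂ] H) where
  toFun χ := berezinTransform K χ
  map_add' _ _ := berezinTransform_add _ _ _
  map_smul' _ _ := berezinTransform_smul _ _ _

/-- This is a Kraus decomposition `K^*(χ ⊗ I)K = ∑ K_i^* χ K_i`, where `K_i` is the slice of `K` at
the basis vector `b_i`. Complete positivity and `w^*`-continuity are both read off from it. -/
theorem hasSum_inner_berezinTransform [CompleteSpace N] {I : Type*} (b : HilbertBasis I ℂ F)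
    (K : H →L[ℂ] HTensor N F) (χ : N →L[ℂ] N) (x y : H) :
    HasSum (fun i => ⟪(tensorRight (b i)).adjoint (K y), χ ((tensorRight (b i)).adjoint (K x))⟫_ℂ)
      ⟪y, berezinTransform K χ x⟫_ℂ := by
  have h := hasSum_inner_adjoint_tensorRight b (K y) (tensorId χ F (K x))
  simp only [adjoint_tensorRight_tensorId] at h
  rwa [berezinTransform, ContinuousLinearMap.comp_apply, ContinuousLinearMap.comp_apply,
    adjoint_inner_right]

open scoped ComplexOrder in
theorem berezinMap_isCompletelyPositive [CompleteSpace N] [CompleteSpace F] (K : H →L[ℂ] HTensor N F)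
    (S : Submodule ℂ (N →L[ℂ] N)) : IsCompletelyPositive (berezinMap K S) := by
  intro k M hM x
  obtain ⟨w, b, -⟩ := exists_hilbertBasis ℂ F
  have h : HasSum (fun r => ∑ i, ∑ j, ⟪(tensorRight (b r)).adjoint (K (x i)),
      (M i j : N →L[ℂ] N) ((tensorRight (b r)).adjoint (K (x j)))⟫_ℂ)
      (∑ i, ∑ j, ⟪x i, berezinMap K S (M i j) (x j)⟫_ℂ) :=
    hasSum_sum fun i _ => hasSum_sum fun j _ =>
      hasSum_inner_berezinTransform b K (M i j : N →L[ℂ] N) (x j) (x i)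
  exact h.nonneg fun r => hM fun i => (tensorRight (b r)).adjoint (K (x i))

theorem continuous_weakStar_apply (v : lp (fun _ : ℕ => N) 2 × lp (fun _ : ℕ => N) 2) :
    @Continuous _ _ (weakStar N) _ fun T : N →L[ℂ] N => ∑' n, ⟪v.2 n, T (v.1 n)⟫_ℂ := by
  let _ := weakStar N
  have h : Continuous fun (T : N →L[ℂ] N) (v : lp (fun _ : ℕ => N) 2 × lp (fun _ : ℕ => N) 2) =>
      (∑' n, ⟪v.2 n, T (v.1 n)⟫_ℂ : ℂ) := continuous_induced_dom
  exact (continuous_apply v).comp h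

/-- The functionals `T ↦ ∑ ⟪q_i, T p_i⟫` with square summable families `p`, `q` over an arbitrary
index set are `w^*`-continuous. -/
theorem continuous_weakStar_tsum {I : Type*} (p q : lp (fun _ : I => N) 2) :
    @Continuous _ _ (weakStar N) _ fun T : N →L[ℂ] N => ∑' i, ⟪q i, T (p i)⟫_ℂ := by
  have hsum : ∀ v : lp (fun _ : I => N) 2, (Function.support fun i => ‖v i‖ ^ 2).Countable :=
    fun v => (hasSum_norm_sq_lp v).summable.countable_support
  have hmemp : ∀ (v : lp (fun _ : I => N) 2) i, v i ≠ 0 →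
      i ∈ Function.support fun i => ‖v i‖ ^ 2 := fun v i hi => by simpa using hi
  -- A square summable family has countable support, so both families can be moved to `ℕ` and
  -- extended by zero.
  obtain ⟨s, hs, hp, hq⟩ : ∃ s : Set I, s.Countable ∧ (∀ i ∉ s, p i = 0) ∧ ∀ i ∉ s, q i = 0 :=
    ⟨_, (hsum p).union (hsum q), fun i hi => by_contra fun h => hi (Or.inl (hmemp p i h)),
      fun i hi => by_contra fun h => hi (Or.inr (hmemp q i h))⟩
  have := hs.to_subtype
  obtain ⟨e, he⟩ := exists_injective_nat s
  have hext : ∀ v : lp (fun _ : I => N) 2,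
      Memℓp (Function.extend e (fun i : s => v i) 0) 2 := fun v => by
    refine memℓp_gen ?_
    have h1 : Summable fun i : s => ‖v i‖ ^ 2 := (hasSum_norm_sq_lp v).summable.subtype s
    have h2 : (fun i : s => ‖v i‖ ^ 2) =
        (fun n => ‖Function.extend e (fun i : s => v i) 0 n‖ ^ (2 : ℝ≥0∞).toReal) ∘ e := by
      ext i
      simp [he.extend_apply]
    rw [h2] at h1
    refine (he.summable_iff fun n hn => ?_).1 h1
    rw [Function.extend_apply' _ _ _ (by simpa using hn)]
    simp
  let p' : lp (fun _ : ℕ => N) 2 := ⟨_, hext p⟩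
  let q' : lp (fun _ : ℕ => N) 2 := ⟨_, hext q⟩
  have hpq : ∀ T : N →L[ℂ] N, ∑' n, ⟪q' n, T (p' n)⟫_ℂ = ∑' i, ⟪q i, T (p i)⟫_ℂ := fun T => by
    have h1 : Function.support (fun n => ⟪q' n, T (p' n)⟫_ℂ) ⊆ Set.range e := by
      intro n hn
      by_contra h
      refine hn ?_
      have : p' n = 0 :=
        Function.extend_apply' (f := e) (fun i : s => p i) 0 n (by simpa using h)
      simp only [this, map_zero, inner_zero_right]
    have h2 : Function.support (fun i => ⟪q i, T (p i)⟫_ℂ) ⊆ s := by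
      intro i hi
      by_contra h
      refine hi ?_
      simp only [hp i h, map_zero, inner_zero_right]
    rw [← he.tsum_eq h1, ← tsum_subtype_eq_of_support_subset h2]
    refine tsum_congr fun i => ?_
    have h3 : p' (e i) = p i := he.extend_apply (fun i : s => p i) 0 i
    have h4 : q' (e i) = q i := he.extend_apply (fun i : s => q i) 0 i
    rw [h3, h4]
  simpa only [hpq] using continuous_weakStar_apply (p', q')

/-- Pulling back a functional given by sequences `x_n`, `y_n` gives the functional of the families
`K_r x_n`, `K_r y_n`, which are square summable over the pairs `(n, r)`. -/
theorem continuous_weakStar_berezinTransform [CompleteSpace N] [CompleteSpace F] (K : H →L[ℂ] HTensor N F) :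
    @Continuous _ _ (weakStar N) (weakStar H) (berezinTransform K) := by
  obtain ⟨w, b, -⟩ := exists_hilbertBasis ℂ F
  have hc : ∀ h, Summable fun r => ‖((tensorRight (b r)).adjoint ∘L K) h‖ ^ 2 := fun h => by
    have h1 := Complex.hasSum_re (hasSum_inner_adjoint_tensorRight b (K h) (K h))
    simpa [inner_self_eq_norm_sq_to_K, ← Complex.ofReal_pow] using h1.summable
  let _ := weakStar N
  refine continuous_induced_rng.2 (continuous_pi fun v => ?_)
  let p : lp (fun _ : ℕ × w => N) 2 := ⟨_, memℓp_prod _ hc v.1⟩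
  let q : lp (fun _ : ℕ × w => N) 2 := ⟨_, memℓp_prod _ hc v.2⟩
  refine (continuous_weakStar_tsum p q).congr fun T => ?_
  obtain ⟨M, hM⟩ := exists_lpMap (ℕ × w) T
  have hs : Summable fun i => ⟪q i, T (p i)⟫_ℂ := by
    simpa only [hM] using lp.summable_inner (𝕜 := ℂ) q (M p)
  rw [hs.tsum_prod]
  exact tsum_congr fun n => (hasSum_inner_berezinTransform b K T (v.1 n) (v.2 n)).tsum_eq

end BerezinTransform

/-! ### The weighted shifts and the model tuple `B` -/

section FockBasis

variable {ι : Type*}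

/-- The canonical orthonormal basis of the Fock space. -/
noncomputable def fockBasis (ι : Type*) : HilbertBasis (FreeMonoid ι) ℂ (Fock ι) :=
  HilbertBasis.ofRepr (LinearIsometryEquiv.refl ℂ _)

theorem fockBasis_apply (α : FreeMonoid ι) : fockBasis ι α = basisVec α := by
  classical
  rw [← (fockBasis ι).repr_symm_single]
  unfold basisVec
  rfl

end FockBasis

namespace PositiveRegular

variable {ι : Type*} (f : PositiveRegular ι) (m : ℕ) (P : Set (FreeAlgebra ℂ ι))

theorem word_shift_basisVec (α β : FreeMonoid ι) :
    word (f.shift m) α (basisVec β) =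
      ((√(f.weight m β / f.weight m (α * β)) : ℝ) : ℂ) • basisVec (α * β) := by
  induction α using FreeMonoid.inductionOn' with
  | one =>
    rw [word_one, one_mul, div_self (f.weight_pos m β).ne', Real.sqrt_one, Complex.ofReal_one,
      one_smul]
    rfl
  | of_mul i γ ih =>
    rw [word_mul, word_of, ContinuousLinearMap.comp_apply, ih, map_smul, shift_basisVec, smul_smul,
      ← mul_assoc, ← Complex.ofReal_mul, ← Real.sqrt_mul (div_nonneg (f.weight_pos m _).le
        (f.weight_pos m _).le), div_mul_div_cancel₀ (f.weight_pos m _).ne']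

theorem basisVec_eq_word (α : FreeMonoid ι) :
    basisVec α = ((√(f.weight m α) : ℝ) : ℂ) • word (f.shift m) α (basisVec 1) := by
  rw [word_shift_basisVec, mul_one, smul_smul, ← Complex.ofReal_mul,
    ← Real.sqrt_mul (f.weight_pos m _).le, weight_one, mul_one_div,
    div_self (f.weight_pos m α).ne', Real.sqrt_one, Complex.ofReal_one, one_smul]

theorem mem_modelSpace_iff (x : Fock ι) : x ∈ f.modelSpace m P ↔ ∀ p ∈ P, ∀ α β : FreeMonoid ι,
    ⟪word (f.shift m) α (evalPoly (f.shift m) p (word (f.shift m) β (basisVec 1))), x⟫_ℂ = 0 := by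
  rw [modelSpace, relSpace, Submodule.orthogonal_closure]
  constructor
  · intro h p hp α β
    exact (Submodule.mem_orthogonal _ _).1 h _ (Submodule.subset_span ⟨p, hp, α, β, rfl⟩)
  · intro h
    rw [← Submodule.span_singleton_le_iff_mem, ← Submodule.isOrtho_iff_le, Submodule.isOrtho_comm,
      Submodule.isOrtho_span]
    rintro _ ⟨p, hp, α, β, rfl⟩ _ rfl
    exact h p hp α β

/-- The generators of `M_P` are stable under `W_i`, which only lengthens the left word; so `N_P` is
invariant under `W_i^*` and `B_i^*` is a plain restriction. -/
theorem adjoint_shift_mem (i : ι) {x : Fock ι} (hx : x ∈ f.modelSpace m P) :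
    (f.shift m i).adjoint x ∈ f.modelSpace m P := by
  rw [mem_modelSpace_iff] at hx ⊢
  intro p hp α β
  rw [adjoint_inner_right, ← hx p hp (FreeMonoid.of i * α) β, word_mul, word_of]
  rfl

theorem adjoint_subtypeL :
    (f.modelSpace m P).subtypeL.adjoint = (f.modelSpace m P).orthogonalProjectionOnto :=
  Submodule.adjoint_subtypeL _

theorem adjoint_orthogonalProjectionOnto :
    (f.modelSpace m P).orthogonalProjectionOnto.adjoint = (f.modelSpace m P).subtypeL :=
  Submodule.adjoint_orthogonalProjectionOnto _

theorem coe_adjoint_model (i : ι) (x : f.modelSpace m P) :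
    ((f.model m P i).adjoint x : Fock ι) = (f.shift m i).adjoint x := by
  rw [model, adjoint_comp, adjoint_comp, adjoint_orthogonalProjectionOnto, adjoint_subtypeL]
  exact Submodule.starProjection_eq_self_iff.2 (f.adjoint_shift_mem m P i x.2)

theorem coe_adjoint_word_model (α : FreeMonoid ι) (x : f.modelSpace m P) :
    ((word (f.model m P) α).adjoint x : Fock ι) = (word (f.shift m) α).adjoint x := by
  induction α using FreeMonoid.inductionOn' generalizing x with
  | one => rw [adjoint_word_one, adjoint_word_one]
  | of_mul i γ ih =>
    rw [adjoint_word_mul, adjoint_word_mul, ih, word_of, word_of, coe_adjoint_model]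

theorem inner_basisVec (α : FreeMonoid ι) (x : f.modelSpace m P) :
    ⟪basisVec α, (x : Fock ι)⟫_ℂ = ((√(f.weight m α) : ℝ) : ℂ) *
      ⟪basisVec 1, ((word (f.model m P) α).adjoint x : Fock ι)⟫_ℂ := by
  rw [coe_adjoint_word_model, adjoint_inner_right, f.basisVec_eq_word m α, inner_smul_left,
    Complex.conj_ofReal]

theorem projection_basisVec (α : FreeMonoid ι) :
    (f.modelSpace m P).orthogonalProjectionOnto (basisVec α) = ((√(f.weight m α) : ℝ) : ℂ) •
      word (f.model m P) α ((f.modelSpace m P).orthogonalProjectionOnto (basisVec 1)) := by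
  refine ext_inner_right ℂ fun x => ?_
  rw [inner_smul_left, Complex.conj_ofReal, ← adjoint_inner_right, ← adjoint_inner_right,
    adjoint_orthogonalProjectionOnto, ← adjoint_inner_right, adjoint_orthogonalProjectionOnto]
  exact f.inner_basisVec m P α x

/-- Parseval's identity, written with the model operators. -/
theorem hasSum_weight_model (x : f.modelSpace m P) :
    HasSum (fun α => f.weight m α *
      ‖(innerSL ℂ (basisVec 1) ∘L (f.modelSpace m P).subtypeL)
        ((word (f.model m P) α).adjoint x)‖ ^ 2) (‖x‖ ^ 2) := by
  have h := hasSum_norm_sq_lp ((fockBasis ι).repr (x : Fock ι))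
  rw [LinearIsometryEquiv.norm_map] at h
  have e : ∀ α, ‖(fockBasis ι).repr (x : Fock ι) α‖ ^ 2 = f.weight m α *
      ‖(innerSL ℂ (basisVec 1) ∘L (f.modelSpace m P).subtypeL)
        ((word (f.model m P) α).adjoint x)‖ ^ 2 := fun α => by
    rw [HilbertBasis.repr_apply_apply, fockBasis_apply, inner_basisVec, norm_mul, mul_pow,
      Complex.norm_real, Real.norm_eq_abs, sq_abs, Real.sq_sqrt (f.weight_pos m α).le]
    rfl
  simpa only [e, Submodule.coe_norm] using h

/-- With `T` the pairing with the vacuum, the Fock coordinates of `x ∈ N_P` are `√b_α T B_α^* x`;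
Parseval's identity then exhibits `I` as a weighted form. -/
theorem isForm_model : IsForm (f.model m P)
    (innerSL ℂ (basisVec 1) ∘L (f.modelSpace m P).subtypeL) (f.weight m) 1 := by
  refine ⟨isPositive_one, fun x => ?_⟩
  have e : (⟪x, (1 : f.modelSpace m P →L[ℂ] f.modelSpace m P) x⟫_ℂ).re = ‖x‖ ^ 2 :=
    inner_self_eq_norm_sq (𝕜 := ℂ) x
  rw [e]
  exact f.hasSum_weight_model m P x

variable {m}

/-- The coefficients of `f · b` are at most those of `b`, so the convolved series is dominated by
Parseval's. Regrouped by the first factor it is `∑ a_α ‖B_α^* x‖²`. -/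
theorem formBounded_model (hm : 1 ≤ m) : FormBounded f (f.model m P) := fun x => by
  obtain ⟨g, hg⟩ : ∃ g : FreeMonoid ι → ℝ, ∀ α, g α =
      ‖(innerSL ℂ (basisVec 1) ∘L (f.modelSpace m P).subtypeL)
        ((word (f.model m P) α).adjoint x)‖ ^ 2 := ⟨_, fun _ => rfl⟩
  have hg0 : 0 ≤ g := fun α => by rw [hg]; exact sq_nonneg _
  have hw : f.conv (f.weight m) ≤ f.weight m := by
    obtain ⟨n, rfl⟩ : ∃ n, m = n + 1 := ⟨m - 1, by omega⟩
    rw [f.weight_eq_powCoeff hm]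
    exact f.conv_powCoeff_le n
  have hb : 0 ≤ f.weight m := fun α => (f.weight_pos m α).le
  have h1 : Summable fun α => f.weight m α * g α := by
    simpa only [hg] using (f.hasSum_weight_model m P x).summable
  have h2 : Summable fun α => f.conv (f.weight m) α * g α :=
    Summable.of_nonneg_of_le (fun α => mul_nonneg (f.conv_nonneg hb α) (hg0 α))
      (fun α => mul_le_mul_of_nonneg_right (hw α) (hg0 α)) h1
  refine ((f.hasSum_conv_iff hb hg0 (G := fun α => ‖(word (f.model m P) α).adjoint x‖ ^ 2)
    fun α => ?_).1 h2.hasSum).summable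
  simpa only [hg, adjoint_word_mul] using
    f.hasSum_weight_model m P ((word (f.model m P) α).adjoint x)

theorem one_mem_pureCone (hm : 1 ≤ m) : 1 ∈ pureCone f m (f.model m P) :=
  (f.isForm_model m P).mem_pureCone hm (f.formBounded_model P hm)

end PositiveRegular

/-! ### Consequences of the intertwining relation -/

section Intertwining

variable {ι : Type*} {E F H : Type*} [NormedAddCommGroup E] [InnerProductSpace ℂ E]
  [CompleteSpace E] [NormedAddCommGroup F] [InnerProductSpace ℂ F]
  [NormedAddCommGroup H] [InnerProductSpace ℂ H] [CompleteSpace H]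
  {A : ι → H →L[ℂ] H} {X : ι → E →L[ℂ] E} {K : H →L[ℂ] HTensor E F}

theorem intertwine_word (h : ∀ i, K ∘L (A i).adjoint = tensorId (X i).adjoint F ∘L K)
    (α : FreeMonoid ι) :
    K ∘L (word A α).adjoint = tensorId (word X α).adjoint F ∘L K := by
  induction α using FreeMonoid.inductionOn' with
  | one =>
    have h1 : (word A 1).adjoint = 1 := by ext x; exact adjoint_word_one A x
    have h2 : (word X 1).adjoint = 1 := by ext x; exact adjoint_word_one X x
    rw [h1, h2, tensorId_one]
    rfl
  | of_mul i γ ih =>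
    rw [word_mul, word_mul, word_of, word_of, adjoint_comp, adjoint_comp, tensorId_comp,
      ← comp_assoc, ih, comp_assoc, h, comp_assoc]

theorem intertwine_evalPoly (h : ∀ i, K ∘L (A i).adjoint = tensorId (X i).adjoint F ∘L K)
    (p : FreeAlgebra ℂ ι) :
    K ∘L (evalPoly A p).adjoint = tensorId (evalPoly X p).adjoint F ∘L K := by
  induction p using FreeAlgebra.induction with
  | grade0 c =>
    have h1 : (evalPoly A (algebraMap ℂ _ c)).adjoint = (starRingEnd ℂ c) • 1 := by
      rw [evalPoly, AlgHom.commutes, Algebra.algebraMap_eq_smul_one, map_smulₛₗ]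
      exact congrArg _ (star_one (H →L[ℂ] H))
    have h2 : (evalPoly X (algebraMap ℂ _ c)).adjoint = (starRingEnd ℂ c) • 1 := by
      rw [evalPoly, AlgHom.commutes, Algebra.algebraMap_eq_smul_one, map_smulₛₗ]
      exact congrArg _ (star_one (E →L[ℂ] E))
    rw [h1, h2, tensorId_smul, tensorId_one, comp_smul, smul_comp]
    rfl
  | grade1 i =>
    simp only [evalPoly, FreeAlgebra.lift_ι_apply]
    exact h i
  | mul a b ha hb =>
    have h1 : evalPoly A (a * b) = evalPoly A a ∘L evalPoly A b := map_mul _ _ _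
    have h2 : evalPoly X (a * b) = evalPoly X a ∘L evalPoly X b := map_mul _ _ _
    rw [h1, h2, adjoint_comp, adjoint_comp, tensorId_comp, ← comp_assoc, hb, comp_assoc, ha,
      comp_assoc]
  | add a b ha hb =>
    have h1 : evalPoly A (a + b) = evalPoly A a + evalPoly A b := map_add _ _ _
    have h2 : evalPoly X (a + b) = evalPoly X a + evalPoly X b := map_add _ _ _
    rw [h1, h2, map_add, map_add, tensorId_add, comp_add, add_comp, ha, hb]

theorem berezinTransform_word (h : ∀ i, K ∘L (A i).adjoint = tensorId (X i).adjoint F ∘L K)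
    (α β : FreeMonoid ι) :
    berezinTransform K (word X α ∘L (word X β).adjoint) =
      word A α ∘L (K.adjoint ∘L K) ∘L (word A β).adjoint := by
  have h1 := congrArg adjoint (intertwine_word h α)
  rw [adjoint_comp, adjoint_comp, adjoint_adjoint, adjoint_tensorId, adjoint_adjoint] at h1
  rw [berezinTransform, tensorId_comp, comp_assoc, ← intertwine_word h β, ← comp_assoc, ← h1,
    comp_assoc, comp_assoc]

omit [CompleteSpace E] in
theorem berezinTransform_one : berezinTransform K 1 = K.adjoint ∘L K := by
  rw [berezinTransform, tensorId_one]
  rfl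

omit [CompleteSpace E] in
theorem inner_adjoint_comp_self (K : H →L[ℂ] HTensor E F) (h : H) :
    (⟪h, (K.adjoint ∘L K) h⟫_ℂ).re = ‖K h‖ ^ 2 := by
  rw [ContinuousLinearMap.comp_apply, adjoint_inner_right]
  exact inner_self_eq_norm_sq (𝕜 := ℂ) (K h)

end Intertwining

/-! ### From an intertwining operator to the cone -/

section KernelToCone

variable {ι : Type*} {f : PositiveRegular ι} {m : ℕ} {P : Set (FreeAlgebra ℂ ι)}
  {H : Type*} [NormedAddCommGroup H] [InnerProductSpace ℂ H] [CompleteSpace H]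
  {A : ι → H →L[ℂ] H} {F : Type*} [NormedAddCommGroup F] [InnerProductSpace ℂ F] [CompleteSpace F]

theorem adjoint_tensorLeft_smul {E : Type*} [NormedAddCommGroup E] [InnerProductSpace ℂ E]
    (c : ℝ) (x : E) (z : HTensor E F) :
    (tensorLeft ((c : ℂ) • x)).adjoint z = (c : ℂ) • (tensorLeft x).adjoint z := by
  refine ext_inner_left ℂ fun y => ?_
  rw [adjoint_inner_right, tensorLeft_apply, htmul_smul, inner_smul_left, Complex.conj_ofReal,
    inner_smul_right, adjoint_inner_right, tensorLeft_apply]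

theorem hasSum_norm_sq_tensorLeft (z : HTensor (Fock ι) F) :
    HasSum (fun α => ‖(tensorLeft (basisVec α)).adjoint z‖ ^ 2) (‖z‖ ^ 2) := by
  have h := Complex.hasSum_re (hasSum_inner_adjoint_tensorLeft (fockBasis ι) z z)
  simpa [inner_self_eq_norm_sq_to_K, ← Complex.ofReal_pow, fockBasis_apply] using h

omit [CompleteSpace F] in
theorem norm_tensorId_subtypeL (z : HTensor (f.modelSpace m P) F) :
    ‖tensorId (f.modelSpace m P).subtypeL F z‖ ^ 2 = ‖z‖ ^ 2 := by
  have h1 : (f.modelSpace m P).orthogonalProjectionOnto ∘L (f.modelSpace m P).subtypeL = 1 := by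
    ext1 x
    exact Submodule.orthogonalProjectionOnto_mem_subspace_eq_self x
  rw [← inner_self_eq_norm_sq (𝕜 := ℂ), ← inner_self_eq_norm_sq (𝕜 := ℂ), ← adjoint_inner_right,
    adjoint_tensorId, f.adjoint_subtypeL, ← ContinuousLinearMap.comp_apply, ← tensorId_comp, h1,
    tensorId_one]
  rfl

/-- Parseval's identity of the model with multiplicity space `F`: the functional given by the vacuum
is replaced by the slice at its projection to `N_P`. -/
theorem hasSum_weight_tensor (z : HTensor (f.modelSpace m P) F) :
    HasSum (fun α => f.weight m α *
      ‖(tensorLeft ((f.modelSpace m P).orthogonalProjectionOnto (basisVec 1))).adjoint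
        (tensorId (word (f.model m P) α).adjoint F z)‖ ^ 2) (‖z‖ ^ 2) := by
  have h := hasSum_norm_sq_tensorLeft (tensorId (f.modelSpace m P).subtypeL F z)
  rw [norm_tensorId_subtypeL] at h
  have e : ∀ α, ‖(tensorLeft (basisVec α)).adjoint
      (tensorId (f.modelSpace m P).subtypeL F z)‖ ^ 2 = f.weight m α *
      ‖(tensorLeft ((f.modelSpace m P).orthogonalProjectionOnto (basisVec 1))).adjoint
        (tensorId (word (f.model m P) α).adjoint F z)‖ ^ 2 := fun α => by
    rw [adjoint_tensorLeft_tensorId, adjoint_tensorLeft_tensorId, f.adjoint_subtypeL,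
      f.projection_basisVec, adjoint_tensorLeft_smul, norm_smul, mul_pow, Complex.norm_real,
      Real.norm_eq_abs, sq_abs, Real.sq_sqrt (f.weight_pos m α).le, adjoint_adjoint]
  simpa only [e] using h

theorem mem_pureCone_of_kernel (hm : 1 ≤ m) (hA : FormBounded f A)
    (K : H →L[ℂ] HTensor (f.modelSpace m P) F)
    (hK : ∀ i, K ∘L (A i).adjoint = tensorId (f.model m P i).adjoint F ∘L K) :
    K.adjoint ∘L K ∈ pureCone f m A := by
  -- `T` is the vacuum slice of `K`; intertwining turns the slices of `(B_α^* ⊗ I) K h` into `T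
  -- A_α^* h`.
  refine IsForm.mem_pureCone (T :=
    (tensorLeft ((f.modelSpace m P).orthogonalProjectionOnto (basisVec 1))).adjoint ∘L K) hm hA
    ⟨isPositive_adjoint_comp_self K, fun h => ?_⟩
  rw [inner_adjoint_comp_self]
  have e : ∀ α, tensorId (word (f.model m P) α).adjoint F (K h) = K ((word A α).adjoint h) :=
    fun α => congrArg (fun S : H →L[ℂ] HTensor (f.modelSpace m P) F => S h)
      (intertwine_word hK α).symm
  simpa only [e, ContinuousLinearMap.comp_apply] using hasSum_weight_tensor (K h)

end KernelToCone

/-! ### The Berezin kernel and its compression to `N_P` -/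

section Kernel

variable {ι : Type*} {f : PositiveRegular ι} {m : ℕ} {P : Set (FreeAlgebra ℂ ι)}
  {H : Type*} [NormedAddCommGroup H] [InnerProductSpace ℂ H] [CompleteSpace H]
  {A : ι → H →L[ℂ] H}

theorem norm_sq_sqrtInto {R : H →L[ℂ] H} (hR : R.IsPositive) (h : H) :
    ‖sqrtInto R h‖ ^ 2 = (⟪h, R h⟫_ℂ).re := norm_sq_sqrt hR h

/-- The Berezin kernel exists as soon as the series defining `‖K h‖²` converge. -/
theorem exists_isBerezinKernel {R : H →L[ℂ] H} {D : H →L[ℂ] H}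
    (hD : IsForm A (sqrtInto R) (f.weight m) D) :
    ∃ K : H →L[ℂ] HTensor (Fock ι) (defectSpace R), IsBerezinKernel f m A R K := by
  obtain ⟨c, hcdef⟩ : ∃ c : FreeMonoid ι → H →L[ℂ] defectSpace R, ∀ α h, c α h =
      ((√(f.weight m α) : ℝ) : ℂ) • sqrtInto R ((word A α).adjoint h) :=
    ⟨fun α => ((√(f.weight m α) : ℝ) : ℂ) • (sqrtInto R ∘L (word A α).adjoint), fun _ _ => rfl⟩
  have hc : ∀ h, Summable fun α => ‖c α h‖ ^ 2 := fun h => by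
    refine (hD.2 h).summable.congr fun α => ?_
    rw [hcdef, norm_smul, mul_pow, Complex.norm_real, Real.norm_eq_abs, sq_abs,
      Real.sq_sqrt (f.weight_pos m α).le]
  obtain ⟨L, hL⟩ := exists_lpOperator c hc
  have hV := orthogonalFamily_tensorLeft (F := defectSpace R) (orthonormal_basisVec (ι := ι))
  refine ⟨hV.linearIsometry.toContinuousLinearMap ∘L L, fun h => ?_⟩
  have h1 := hV.hasSum_linearIsometry (L h)
  have e : ∀ α, tensorLeftₗᵢ (basisVec α) (orthonormal_basisVec.1 α) (L h α) =
      ((√(f.weight m α) : ℝ) : ℂ) •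
        htmul (basisVec α) (sqrtInto R ((word A α).adjoint h)) := fun α => by
    have h2 : L h α = ((√(f.weight m α) : ℝ) : ℂ) • sqrtInto R ((word A α).adjoint h) :=
      (hL h α).trans (hcdef α h)
    rw [h2, map_smul]
    rfl
  simp only [e] at h1
  exact h1

theorem IsBerezinKernel.slice {R : H →L[ℂ] H} {K : H →L[ℂ] HTensor (Fock ι) (defectSpace R)}
    (hK : IsBerezinKernel f m A R K) (α : FreeMonoid ι) (h : H) :
    (tensorLeft (basisVec α)).adjoint (K h) =
      ((√(f.weight m α) : ℝ) : ℂ) • sqrtInto R ((word A α).adjoint h) := by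
  have h1 := (tensorLeft (F := defectSpace R) (basisVec α)).adjoint.hasSum (hK h)
  refine h1.unique ?_
  have h2 := hasSum_single α (f := fun β : FreeMonoid ι => (tensorLeft (basisVec α)).adjoint
    (((√(f.weight m β) : ℝ) : ℂ) •
      htmul (basisVec β) (sqrtInto R ((word A β).adjoint h)))) fun β hβ => by
    rw [map_smul, adjoint_tensorLeft_htmul, orthonormal_basisVec.2 hβ.symm, zero_smul, smul_zero]
  rwa [map_smul, adjoint_tensorLeft_htmul, inner_self_eq_norm_sq_to_K, orthonormal_basisVec.1,
    RCLike.ofReal_one, one_pow, one_smul] at h2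

theorem ext_tensorLeft {F : Type*} [NormedAddCommGroup F] [InnerProductSpace ℂ F] [CompleteSpace F]
    {z z' : HTensor (Fock ι) F}
    (h : ∀ α, (tensorLeft (basisVec α)).adjoint z = (tensorLeft (basisVec α)).adjoint z') :
    z = z' := by
  have h1 := hasSum_norm_sq_tensorLeft (z - z')
  simp only [map_sub, h, sub_self, norm_zero, ne_eq, OfNat.ofNat_ne_zero, not_false_eq_true,
    zero_pow] at h1
  have h2 := h1.unique hasSum_zero
  exact sub_eq_zero.1 (norm_eq_zero.1 (pow_eq_zero_iff two_ne_zero |>.1 h2))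

variable {R : H →L[ℂ] H} {K : H →L[ℂ] HTensor (Fock ι) (defectSpace R)}

theorem IsBerezinKernel.adjoint_comp_self (hK : IsBerezinKernel f m A R K) {D : H →L[ℂ] H}
    (hD : IsForm A (sqrtInto R) (f.weight m) D) : K.adjoint ∘L K = D := by
  -- Over `ℂ` an operator is determined by its quadratic form, and both forms are real because both
  -- operators are positive.
  refine (ContinuousLinearMap.coe_inj).1 ((_root_.ext_inner_map _ _).1 fun h => ?_)
  have h1 : (⟪h, (K.adjoint ∘L K) h⟫_ℂ).re = (⟪h, D h⟫_ℂ).re := by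
    rw [inner_adjoint_comp_self]
    have e : ∀ α, ‖(tensorLeft (basisVec α)).adjoint (K h)‖ ^ 2 = f.weight m α *
        ‖sqrtInto R ((word A α).adjoint h)‖ ^ 2 := fun α => by
      rw [hK.slice, norm_smul, mul_pow, Complex.norm_real, Real.norm_eq_abs, sq_abs,
        Real.sq_sqrt (f.weight_pos m α).le]
    refine (hasSum_norm_sq_tensorLeft (K h)).unique ?_
    simpa only [e] using hD.2 h
  have h2 : ⟪h, (K.adjoint ∘L K) h⟫_ℂ = ⟪h, D h⟫_ℂ := by
    rw [inner_eq_re_of_isPositive (isPositive_adjoint_comp_self K), h1,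
      ← inner_eq_re_of_isPositive hD.1]
  have h3 := congrArg (starRingEnd ℂ) h2
  rwa [inner_conj_symm, inner_conj_symm] at h3

/-- The `α`-slice of `(W_i^* ⊗ I) K h` is the slice of `K h` at `W_i e_α`, a multiple of `e_{g_i
α}`; the factor `√(b_α / b_{g_i α})` cancels the weight `√b_{g_i α}` to leave `√b_α`. -/
theorem IsBerezinKernel.intertwine (hK : IsBerezinKernel f m A R K) (i : ι) :
    K ∘L (A i).adjoint = tensorId (f.shift m i).adjoint (defectSpace R) ∘L K := by
  ext1 h
  refine ext_tensorLeft fun α => ?_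
  rw [ContinuousLinearMap.comp_apply, ContinuousLinearMap.comp_apply, hK.slice,
    adjoint_tensorLeft_tensorId, adjoint_adjoint, f.shift_basisVec, adjoint_tensorLeft_smul,
    hK.slice, adjoint_word_mul, word_of, smul_smul, ← Complex.ofReal_mul,
    ← Real.sqrt_mul (div_nonneg (f.weight_pos m _).le (f.weight_pos m _).le),
    div_mul_cancel₀ _ (f.weight_pos m _).ne']

/-- Pairing a slice with `W_α p(W) W_β 1` moves `p(W)^*` through `K`, where it becomes `p(A)^* = 0`.
-/
theorem IsBerezinKernel.slice_mem (hK : IsBerezinKernel f m A R K)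
    (hP : ∀ p ∈ P, evalPoly A p = 0) (y : defectSpace R) (h : H) :
    (tensorRight y).adjoint (K h) ∈ f.modelSpace m P := by
  rw [f.mem_modelSpace_iff]
  intro p hp α β
  have hw : ∀ γ x, tensorId (word (f.shift m) γ).adjoint (defectSpace R) (K x) =
      K ((word A γ).adjoint x) := fun γ x =>
    congrArg (fun S : H →L[ℂ] HTensor (Fock ι) (defectSpace R) => S x)
      (intertwine_word hK.intertwine γ).symm
  have hp' : ∀ x, tensorId (evalPoly (f.shift m) p).adjoint (defectSpace R) (K x) = 0 := fun x => by
    have h1 := congrArg (fun S : H →L[ℂ] HTensor (Fock ι) (defectSpace R) => S x)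
      (intertwine_evalPoly hK.intertwine p).symm
    rw [hP p hp] at h1
    refine h1.trans ?_
    simp
  rw [← adjoint_inner_right, ← adjoint_inner_right, ← adjoint_tensorRight_tensorId, hw,
    ← adjoint_tensorRight_tensorId, hp', map_zero, inner_zero_right]

/-- All slices of `K h` lie in `N_P`, so compressing loses nothing: `K_q` inherits `K^* K` and the
intertwining relation. -/
theorem IsBerezinKernel.subtype_constrainedKernel (hK : IsBerezinKernel f m A R K)
    (hP : ∀ p ∈ P, evalPoly A p = 0) :
    tensorId (f.modelSpace m P).subtypeL (defectSpace R) ∘L constrainedKernel f m P K = K := by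
  ext1 h
  refine HTensor.ext_inner fun x y => ?_
  rw [constrainedKernel, ContinuousLinearMap.comp_apply, ContinuousLinearMap.comp_apply,
    ← tensorRight_apply, ← adjoint_inner_right, ← adjoint_inner_right,
    adjoint_tensorRight_tensorId, adjoint_tensorRight_tensorId]
  exact congrArg _ (Submodule.starProjection_eq_self_iff.2 (hK.slice_mem hP y h))

theorem IsBerezinKernel.constrained_adjoint_comp_self (hK : IsBerezinKernel f m A R K)
    (hP : ∀ p ∈ P, evalPoly A p = 0) :
    (constrainedKernel f m P K).adjoint ∘L constrainedKernel f m P K = K.adjoint ∘L K := by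
  conv_lhs =>
    arg 1
    rw [constrainedKernel, adjoint_comp, adjoint_tensorId, f.adjoint_orthogonalProjectionOnto]
  rw [comp_assoc, hK.subtype_constrainedKernel hP]

theorem IsBerezinKernel.constrained_intertwine (hK : IsBerezinKernel f m A R K)
    (hP : ∀ p ∈ P, evalPoly A p = 0) (i : ι) :
    constrainedKernel f m P K ∘L (A i).adjoint =
      tensorId (f.model m P i).adjoint (defectSpace R) ∘L constrainedKernel f m P K := by
  have h1 : (f.model m P i).adjoint = (f.modelSpace m P).orthogonalProjectionOnto ∘L
      (f.shift m i).adjoint ∘L (f.modelSpace m P).subtypeL := by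
    rw [PositiveRegular.model, adjoint_comp, adjoint_comp, f.adjoint_orthogonalProjectionOnto,
      f.adjoint_subtypeL, comp_assoc]
  rw [h1, tensorId_comp, tensorId_comp, comp_assoc, comp_assoc, hK.subtype_constrainedKernel hP,
    constrainedKernel, comp_assoc, hK.intertwine]

end Kernel

/-! ### Convergence in the `w^*`-topology -/

section WeakStarLemmas

variable {N : Type*} [NormedAddCommGroup N] [InnerProductSpace ℂ N]

theorem tendsto_weakStar_iff {J : Type*} {l : Filter J} {T : J → N →L[ℂ] N} {T₀ : N →L[ℂ] N} :
    Tendsto T l (@nhds _ (weakStar N) T₀) ↔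
      ∀ p q : lp (fun _ : ℕ => N) 2,
        Tendsto (fun j => ∑' n, ⟪q n, T j (p n)⟫_ℂ) l (𝓝 (∑' n, ⟪q n, T₀ (p n)⟫_ℂ)) := by
  rw [nhds_induced, tendsto_comap_iff, tendsto_pi_nhds, Prod.forall]
  rfl

theorem continuous_weakStar_inner (x y : N) :
    @Continuous _ _ (weakStar N) _ fun T : N →L[ℂ] N => ⟪y, T x⟫_ℂ := by
  classical
  have hs : ∀ z : N, ∃ u : lp (fun _ : ℕ => N) 2, u 0 = z ∧ ∀ n, n ≠ 0 → u n = 0 := fun z =>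
    ⟨lp.single (E := fun _ : ℕ => N) 2 0 z, lp.single_apply_self (E := fun _ : ℕ => N) 2 0 z,
      fun n hn => lp.single_apply_ne (E := fun _ : ℕ => N) 2 0 z hn⟩
  obtain ⟨u, hu0, -⟩ := hs x
  obtain ⟨v, hv0, hv⟩ := hs y
  have e : ∀ T : N →L[ℂ] N, ∑' n, ⟪v n, T (u n)⟫_ℂ = ⟪y, T x⟫_ℂ := fun T => by
    rw [tsum_eq_single 0 fun n hn => by rw [hv n hn, inner_zero_left], hu0, hv0]
  simpa only [e] using continuous_weakStar_apply (N := N) (u, v)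

theorem t2Space_weakStar : @T2Space (N →L[ℂ] N) (weakStar N) := by
  refine @T2Space.of_injective_continuous _ _ (weakStar N) _ _
    (fun T (v : N × N) => ⟪v.2, T v.1⟫_ℂ) (fun S T h => ?_) ?_
  · ext x
    exact ext_inner_left ℂ fun y => congrFun h (x, y)
  · exact @continuous_pi _ _ _ (weakStar N) _ _ fun v => continuous_weakStar_inner v.1 v.2

/-- The map `T ↦ L T R` is `w^*`-continuous. -/
theorem continuous_weakStar_conj [CompleteSpace N] (L R : N →L[ℂ] N) :
    @Continuous _ _ (weakStar N) (weakStar N) fun T : N →L[ℂ] N => L ∘L T ∘L R := by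
  let _ := weakStar N
  refine continuous_induced_rng.2 (continuous_pi fun v => ?_)
  obtain ⟨M, hM⟩ := exists_lpMap ℕ R
  obtain ⟨M', hM'⟩ := exists_lpMap ℕ L.adjoint
  refine (continuous_weakStar_apply (N := N) (M v.1, M' v.2)).congr fun T => ?_
  refine tsum_congr fun n => ?_
  have h1 : M v.1 n = R (v.1 n) := hM _ _
  have h2 : M' v.2 n = L.adjoint (v.2 n) := hM' _ _
  simp only [h1, h2, adjoint_inner_left]
  rfl

variable {ι : Type*} {f : PositiveRegular ι}

/-- The series defining `Φ_{f,X}(Y)` converges in the `w^*`-topology. -/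
theorem tendsto_weakStar_Phi [CompleteSpace N] {X : ι → N →L[ℂ] N} (hX : FormBounded f X)
    (Y : N →L[ℂ] N) :
    Tendsto (fun s : Finset (FreeMonoid ι) => ∑ α ∈ s,
      (f.coeff α : ℂ) • (word X α ∘L Y ∘L (word X α).adjoint)) atTop
      (@nhds _ (weakStar N) (Phi f X Y)) := by
  rw [tendsto_weakStar_iff]
  intro p q
  obtain ⟨c, hc, hcs⟩ := exists_coeffOperators hX
  let p' : lp (fun _ : ℕ × FreeMonoid ι => N) 2 := ⟨_, memℓp_prod c hcs p⟩
  let q' : lp (fun _ : ℕ × FreeMonoid ι => N) 2 := ⟨_, memℓp_prod c hcs q⟩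
  obtain ⟨M, hM⟩ := exists_lpMap (ℕ × FreeMonoid ι) Y
  -- Summability over pairs, not just iterated, is what allows the sums over `n` and over words to
  -- be exchanged.
  have hs : Summable fun i : ℕ × FreeMonoid ι => ⟪c i.2 (q i.1), Y (c i.2 (p i.1))⟫_ℂ := by
    have h := lp.summable_inner (𝕜 := ℂ) q' (M p')
    have e : ∀ i, ⟪q' i, M p' i⟫_ℂ = ⟪c i.2 (q i.1), Y (c i.2 (p i.1))⟫_ℂ := fun i =>
      congrArg (fun w => ⟪q' i, w⟫_ℂ) (hM p' i)
    simpa only [e] using h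
  have hcc : ∀ α x y, ⟪c α y, Y (c α x)⟫_ℂ =
      (f.coeff α : ℂ) * ⟪(word X α).adjoint y, Y ((word X α).adjoint x)⟫_ℂ := fun α x y => by
    rw [hc, hc, map_smul, inner_smul_left, inner_smul_right, Complex.conj_ofReal,
      ← mul_assoc, ← Complex.ofReal_mul, Real.mul_self_sqrt (f.coeff_nonneg α)]
  have h1 : ∀ n, HasSum (fun α => ⟪c α (q n), Y (c α (p n))⟫_ℂ) ⟪q n, Phi f X Y (p n)⟫_ℂ :=
    fun n => by
      simp only [hcc]
      exact hasSum_inner_Phi hX Y (p n) (q n)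
  have h2 : HasSum (fun α => ∑' n, ⟪c α (q n), Y (c α (p n))⟫_ℂ)
      (∑' n, ⟪q n, Phi f X Y (p n)⟫_ℂ) := by
    have h3 : ∑' n, ⟪q n, Phi f X Y (p n)⟫_ℂ =
        ∑' i : ℕ × FreeMonoid ι, ⟪c i.2 (q i.1), Y (c i.2 (p i.1))⟫_ℂ := by
      rw [hs.tsum_prod]
      exact tsum_congr fun n => (h1 n).tsum_eq.symm
    rw [h3]
    have hs' := hs.prod_symm
    rw [← (Equiv.prodComm (FreeMonoid ι) ℕ).tsum_eq]
    exact hs'.hasSum.prod_fiberwise fun α => (hs'.prod_factor α).hasSum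
  refine h2.congr fun s => ?_
  have h4 : ∀ α, Summable fun n => ⟪c α (q n), Y (c α (p n))⟫_ℂ := hs.prod_symm.prod_factor
  rw [← Summable.tsum_finsetSum fun α _ => h4 α]
  refine tsum_congr fun n => ?_
  rw [sum_apply, inner_sum]
  refine Finset.sum_congr rfl fun α _ => ?_
  rw [hcc, _root_.smul_apply, inner_smul_right, adjoint_inner_left]
  rfl

/-- A sequence of operators converging strongly to `0` converges to `0` in the `w^*`-topology. -/
theorem tendsto_weakStar_zero [CompleteSpace N] {T : ℕ → N →L[ℂ] N}
    (hT : ∀ x, Tendsto (fun k => T k x) atTop (𝓝 0)) :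
    Tendsto T atTop (@nhds _ (weakStar N) 0) := by
  -- Uniform boundedness supplies the dominating series for the sum over `n`.
  obtain ⟨C, hC⟩ := banach_steinhaus (g := T) fun x => by
    obtain ⟨C, hC⟩ := (hT x).norm.bddAbove_range
    exact ⟨C, fun k => hC ⟨k, rfl⟩⟩
  rw [tendsto_weakStar_iff]
  intro p q
  refine tendsto_tsum_of_dominated_convergence
    (bound := fun n => C * (‖p n‖ ^ 2 + ‖q n‖ ^ 2)) ?_ (fun n => ?_)
    (Eventually.of_forall fun k n => ?_)
  · exact ((hasSum_norm_sq_lp p).summable.add (hasSum_norm_sq_lp q).summable).mul_left C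
  · exact tendsto_const_nhds.inner (hT (p n))
  · have h1 : ‖T k (p n)‖ ≤ C * ‖p n‖ := (T k).le_of_opNorm_le (hC k) _
    have hC0 : 0 ≤ C := (norm_nonneg _).trans (hC k)
    refine (norm_inner_le_norm _ _).trans ((mul_le_mul_of_nonneg_left h1 (norm_nonneg _)).trans ?_)
    have h2 : ‖q n‖ * ‖p n‖ ≤ ‖p n‖ ^ 2 + ‖q n‖ ^ 2 := by
      nlinarith [sq_nonneg (‖p n‖ - ‖q n‖), sq_nonneg ‖p n‖, sq_nonneg ‖q n‖]
    calc ‖q n‖ * (C * ‖p n‖) = C * (‖q n‖ * ‖p n‖) := by ring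
      _ ≤ _ := mul_le_mul_of_nonneg_left h2 hC0

theorem isClosed_weakStarClosure (S : Submodule ℂ (N →L[ℂ] N)) :
    @IsClosed _ (weakStar N) (weakStarClosure S : Set (N →L[ℂ] N)) := by
  let _ := weakStar N
  have := weakStar_continuousAdd N
  have := weakStar_continuousConstSMul N
  exact S.isClosed_topologicalClosure

theorem weakStarClosure_subset {S : Submodule ℂ (N →L[ℂ] N)} {C : Set (N →L[ℂ] N)}
    (hC : @IsClosed _ (weakStar N) C) (h : (S : Set (N →L[ℂ] N)) ⊆ C) :
    (weakStarClosure S : Set (N →L[ℂ] N)) ⊆ C := by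
  let _ := weakStar N
  have := weakStar_continuousAdd N
  have := weakStar_continuousConstSMul N
  exact closure_minimal h hC

end WeakStarLemmas

/-! ### Admissible completely positive maps and their values at `I` -/

section CPMaps

variable {ι : Type*} {f : PositiveRegular ι} {m : ℕ} {P : Set (FreeAlgebra ℂ ι)}
variable {H : Type*} [NormedAddCommGroup H] [InnerProductSpace ℂ H]

/-- Two `w^*`-continuous linear maps on `S` agree if they agree on the operators `B_α B_β^*`. -/
theorem opSystem_ext {φ ψ : opSystem f m P →ₗ[ℂ] (H →L[ℂ] H)}
    (hφ : Continuous[(weakStar (f.modelSpace m P)).induced Subtype.val, weakStar H] φ)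
    (hψ : Continuous[(weakStar (f.modelSpace m P)).induced Subtype.val, weakStar H] ψ)
    (h : ∀ α β, φ (opWord f m P α β) = ψ (opWord f m P α β)) : φ = ψ := by
  let _ := weakStar (f.modelSpace m P)
  let _ := weakStar H
  have : T2Space (H →L[ℂ] H) := t2Space_weakStar
  have hcl : IsClosed {χ | φ χ = ψ χ} := isClosed_eq hφ hψ
  -- The equalizer is closed only relative to `S`; it is the trace of a `w^*`-closed set `C` of
  -- `B(N_P)` containing the span, hence all of `S`.
  obtain ⟨C, hC, hCeq⟩ := isClosed_induced_iff.1 hcl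
  have hspan : ∀ T (hT : T ∈ Submodule.span ℂ
      {T | ∃ α β : FreeMonoid ι, T = modelWord f m P α β}),
      φ ⟨T, le_weakStarClosure _ hT⟩ = ψ ⟨T, le_weakStarClosure _ hT⟩ := by
    intro T hT
    induction hT using Submodule.span_induction with
    | mem T hT =>
      obtain ⟨α, β, rfl⟩ := hT
      exact h α β
    | zero => exact (map_zero φ).trans (map_zero ψ).symm
    | add S T hS hT ihS ihT =>
      exact (map_add φ ⟨S, le_weakStarClosure _ hS⟩ ⟨T, le_weakStarClosure _ hT⟩).trans
        ((congrArg₂ _ ihS ihT).trans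
          (map_add ψ ⟨S, le_weakStarClosure _ hS⟩ ⟨T, le_weakStarClosure _ hT⟩).symm)
    | smul c T hT ih =>
      exact (map_smul φ c ⟨T, le_weakStarClosure _ hT⟩).trans
        ((congrArg _ ih).trans (map_smul ψ c ⟨T, le_weakStarClosure _ hT⟩).symm)
  have hsub : (opSystem f m P : Set _) ⊆ C := weakStarClosure_subset hC fun T hT => by
    have h1 : (⟨T, le_weakStarClosure _ hT⟩ : opSystem f m P) ∈ Subtype.val ⁻¹' C := by
      rw [hCeq]
      exact hspan T hT
    exact h1
  refine LinearMap.ext fun χ => ?_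
  have h2 : χ ∈ Subtype.val ⁻¹' C := hsub χ.2
  rw [hCeq] at h2
  exact h2

variable [CompleteSpace H] {A : ι → H →L[ℂ] H}

theorem modelWord_conj (γ α β : FreeMonoid ι) :
    word (f.model m P) γ ∘L modelWord f m P α β ∘L (word (f.model m P) γ).adjoint =
      modelWord f m P (γ * α) (γ * β) := by
  rw [modelWord, modelWord, word_mul, word_mul, adjoint_comp]
  rfl

theorem conj_mem_opSystem (γ : FreeMonoid ι) {T : f.modelSpace m P →L[ℂ] f.modelSpace m P}
    (hT : T ∈ opSystem f m P) :
    word (f.model m P) γ ∘L T ∘L (word (f.model m P) γ).adjoint ∈ opSystem f m P := by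
  let _ := weakStar (f.modelSpace m P)
  have hc := continuous_weakStar_conj (word (f.model m P) γ) (word (f.model m P) γ).adjoint
  have hcl := (isClosed_weakStarClosure (Submodule.span ℂ
    {T | ∃ α β : FreeMonoid ι, T = modelWord f m P α β})).preimage hc
  refine weakStarClosure_subset hcl (fun T hT => ?_) hT
  refine le_weakStarClosure _ (?_ : word (f.model m P) γ ∘L T ∘L
    (word (f.model m P) γ).adjoint ∈ _)
  induction hT using Submodule.span_induction with
  | mem T hT =>
    obtain ⟨α, β, rfl⟩ := hT
    rw [modelWord_conj]
    exact Submodule.subset_span ⟨_, _, rfl⟩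
  | zero => rw [zero_comp, comp_zero]; exact Submodule.zero_mem _
  | add S T _ _ ihS ihT => rw [add_comp, comp_add]; exact Submodule.add_mem _ ihS ihT
  | smul c T _ ih => rw [smul_comp, comp_smul]; exact Submodule.smul_mem _ c ih

/-- Compression `χ ↦ B_γ χ B_γ^*` as a linear map on `S`. -/
noncomputable def opConj (f : PositiveRegular ι) (m : ℕ) (P : Set (FreeAlgebra ℂ ι))
    (γ : FreeMonoid ι) : opSystem f m P →ₗ[ℂ] opSystem f m P where
  toFun χ := ⟨_, conj_mem_opSystem γ χ.2⟩
  map_add' S T := by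
    ext1
    exact (congrArg _ (add_comp _ _ _)).trans (comp_add _ _ _)
  map_smul' c T := by
    ext1
    exact (congrArg _ (smul_comp c _ _)).trans (comp_smul _ c _)

/-- Both sides are `w^*`-continuous in `χ`, and on `B_α B_β^*` both equal `A_{γα} φ(I) A_{γβ}^*`. -/
theorem cpMaps_conj {φ : opSystem f m P →ₗ[ℂ] (H →L[ℂ] H)} (hφ : φ ∈ cpMaps f m P A)
    (γ : FreeMonoid ι) (χ : opSystem f m P) :
    φ (opConj f m P γ χ) = word A γ ∘L φ χ ∘L (word A γ).adjoint := by
  let ψ : opSystem f m P →ₗ[ℂ] (H →L[ℂ] H) :=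
    { toFun := fun χ => word A γ ∘L φ χ ∘L (word A γ).adjoint
      map_add' := fun S T => by rw [map_add, add_comp, comp_add]
      map_smul' := fun c T => by rw [map_smul, smul_comp, comp_smul]; rfl }
  have h : φ ∘ₗ opConj f m P γ = ψ := by
    let _ := weakStar (f.modelSpace m P)
    let _ := weakStar H
    refine opSystem_ext ?_ ?_ fun α β => ?_
    · refine hφ.2.1.comp (continuous_induced_rng.2 ?_)
      exact (continuous_weakStar_conj (word (f.model m P) γ)
        (word (f.model m P) γ).adjoint).comp continuous_induced_dom
    · exact (continuous_weakStar_conj (word A γ) (word A γ).adjoint).comp hφ.2.1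
    · have h1 : opConj f m P γ (opWord f m P α β) = opWord f m P (γ * α) (γ * β) :=
        Subtype.ext (modelWord_conj γ α β)
      have h2 := hφ.2.2
      rw [LinearMap.comp_apply, h1, h2, word_mul, word_mul, adjoint_comp]
      refine Eq.trans ?_ (congrArg (fun Z => word A γ ∘L Z ∘L (word A γ).adjoint) (h2 α β)).symm
      rfl
  exact LinearMap.congr_fun h χ

/-- The partial sums of `Φ_B(Z)` lie in `S` and converge in the `w^*`-topology, so the limit is in
`S` and `φ` may be applied termwise. Membership and formula are proved together because `φ` is
defined only on `S`. -/
theorem cpMaps_phi (hm : 1 ≤ m) (hA : FormBounded f A)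
    {φ : opSystem f m P →ₗ[ℂ] (H →L[ℂ] H)} (hφ : φ ∈ cpMaps f m P A)
    {Z : f.modelSpace m P →L[ℂ] f.modelSpace m P} (hZ : Z ∈ opSystem f m P) :
    ∃ h : Phi f (f.model m P) Z ∈ opSystem f m P, φ ⟨_, h⟩ = Phi f A (φ ⟨Z, hZ⟩) := by
  let _ := weakStar (f.modelSpace m P)
  let _ := weakStar H
  have ht := tendsto_weakStar_Phi (f.formBounded_model P hm) Z
  let G : Finset (FreeMonoid ι) → opSystem f m P := fun s =>
    ∑ α ∈ s, (f.coeff α : ℂ) • opConj f m P α ⟨Z, hZ⟩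
  have hG : ∀ s, (G s : f.modelSpace m P →L[ℂ] f.modelSpace m P) = ∑ α ∈ s, (f.coeff α : ℂ) •
      (word (f.model m P) α ∘L Z ∘L (word (f.model m P) α).adjoint) := fun s => by
    rw [Submodule.coe_sum]
    rfl
  simp only [← hG] at ht
  have hmem : Phi f (f.model m P) Z ∈ opSystem f m P :=
    (isClosed_weakStarClosure _).mem_of_tendsto ht (Eventually.of_forall fun s => (G s).2)
  refine ⟨hmem, ?_⟩
  have ht' : Tendsto G atTop (𝓝 ⟨_, hmem⟩) := tendsto_subtype_rng.2 ht
  have h1 := (hφ.2.1.tendsto _).comp ht'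
  ext x
  refine ext_inner_left ℂ fun y => ?_
  have h2 := ((continuous_weakStar_inner x y).tendsto _).comp h1
  refine tendsto_nhds_unique (h2.congr fun s => ?_) (hasSum_inner_Phi hA (φ ⟨Z, hZ⟩) x y)
  simp only [Function.comp_apply, G, map_sum, map_smul, cpMaps_conj hφ, sum_apply, inner_sum,
    _root_.smul_apply, inner_smul_right, adjoint_inner_left]
  rfl

theorem cpMaps_isPositive {φ : opSystem f m P →ₗ[ℂ] (H →L[ℂ] H)} (hφ : φ ∈ cpMaps f m P A)
    {Z : opSystem f m P} (hZ : (Z : f.modelSpace m P →L[ℂ] f.modelSpace m P).IsPositive) :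
    (φ Z).IsPositive := by
  have h := hφ.1 1 (fun _ _ => Z) fun x => by
    simpa using hZ.inner_nonneg_right (x 0)
  rw [isPositive_iff_complex]
  intro x
  have h1 := h fun _ => x
  simp only [Finset.univ_unique, Finset.sum_singleton] at h1
  rw [Complex.le_def] at h1
  have h2 : ⟪φ Z x, x⟫_ℂ = ((⟪x, φ Z x⟫_ℂ).re : ℂ) := by
    rw [← inner_conj_symm]
    generalize ⟪x, φ Z x⟫_ℂ = z at h1
    exact Complex.ext (by simp) (by simpa using h1.2.symm)
  rw [h2]
  exact ⟨rfl, h1.1⟩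

theorem cpMaps_defect (hm : 1 ≤ m) (hA : FormBounded f A)
    {φ : opSystem f m P →ₗ[ℂ] (H →L[ℂ] H)} (hφ : φ ∈ cpMaps f m P A) (s : ℕ) :
    ∃ h : defect f (f.model m P) s 1 ∈ opSystem f m P,
      φ ⟨_, h⟩ = defect f A s (φ (opOne f m P)) := by
  induction s with
  | zero => exact ⟨one_mem_opSystem f m P, rfl⟩
  | succ s ih =>
    obtain ⟨h, e⟩ := ih
    obtain ⟨h', e'⟩ := cpMaps_phi hm hA hφ h
    simp only [defect_succ]
    refine ⟨Submodule.sub_mem _ h h', ?_⟩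
    rw [← e, ← e', ← map_sub]
    rfl

theorem cpMaps_phi_iterate (hm : 1 ≤ m) (hA : FormBounded f A)
    {φ : opSystem f m P →ₗ[ℂ] (H →L[ℂ] H)} (hφ : φ ∈ cpMaps f m P A) (k : ℕ) :
    ∃ h : (Phi f (f.model m P))^[k] 1 ∈ opSystem f m P,
      φ ⟨_, h⟩ = (Phi f A)^[k] (φ (opOne f m P)) := by
  induction k with
  | zero => exact ⟨one_mem_opSystem f m P, rfl⟩
  | succ k ih =>
    obtain ⟨h, e⟩ := ih
    obtain ⟨h', e'⟩ := cpMaps_phi hm hA hφ h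
    simp only [Function.iterate_succ_apply']
    exact ⟨h', e'.trans (congrArg _ e)⟩

/-- `φ(I)` belongs to the cone of pure solutions. -/
theorem cpMaps_mem_pureCone (hm : 1 ≤ m) (hA : FormBounded f A)
    {φ : opSystem f m P →ₗ[ℂ] (H →L[ℂ] H)} (hφ : φ ∈ cpMaps f m P A) :
    φ (opOne f m P) ∈ pureCone f m A := by
  have hB := f.one_mem_pureCone P hm
  have hdef : ∀ s, 1 ≤ s → s ≤ m → (defect f A s (φ (opOne f m P))).IsPositive :=
    fun s hs hsm => by
      obtain ⟨h, e⟩ := cpMaps_defect hm hA hφ s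
      rw [← e]
      exact cpMaps_isPositive hφ (hB.1 s hs hsm)
  have hpos : ∀ k, ((Phi f A)^[k] (φ (opOne f m P))).IsPositive :=
    Phi_iterate_isPositive hA (cpMaps_isPositive hφ isPositive_one)
  refine ⟨hdef, fun x => tendsto_zero_of_re_inner (D := φ (opOne f m P)) hpos (fun k h => ?_)
    (fun h => ?_) x⟩
  -- The case `s = 1` of the defect condition telescopes to `Φ^k(φ(I)) ≤ φ(I)`, the order bound that
  -- upgrades weak convergence to strong.
  · have h1 : (∑ j ∈ Finset.range k, (Phi f A)^[j]
        (φ (opOne f m P) - Phi f A (φ (opOne f m P)))).IsPositive :=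
      isPositive_sum _ fun j _ => Phi_iterate_isPositive hA (hdef 1 le_rfl hm) j
    rw [sum_phi_iterate hA] at h1
    have h2 := re_inner_self_nonneg_of_isPositive h1 h
    rw [sub_apply, inner_sub_right, Complex.sub_re] at h2
    linarith
  -- `Φ_B^k(I) → 0` strongly, hence in the `w^*`-topology, and `φ` transports this to `Φ_A^k(φ(I))`.
  · choose hmem he using cpMaps_phi_iterate hm hA hφ
    let _ := weakStar (f.modelSpace m P)
    let _ := weakStar H
    have h1 : Tendsto (fun k => (⟨_, hmem k⟩ : opSystem f m P)) atTop (𝓝 0) :=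
      tendsto_subtype_rng.2 (tendsto_weakStar_zero hB.2)
    have h2 := (hφ.2.1.tendsto _).comp h1
    have h3 := ((continuous_weakStar_inner h h).tendsto _).comp h2
    have h4 := (Complex.continuous_re.tendsto _).comp h3
    simpa [Function.comp_def, he] using h4

end CPMaps

end NCVariety

/-! ### The main theorem -/

theorem mainTheorem7 {ι : Type*} [Countable ι] [Nonempty ι]
    (f : PositiveRegular ι) (m : ℕ) (hm : 1 ≤ m)
    (P : Set (FreeAlgebra ℂ ι)) (hP : f.modelSpace m P ≠ ⊥)
    {H : Type u} [NormedAddCommGroup H] [InnerProductSpace ℂ H] [CompleteSpace H]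
    (A : ι → H →L[ℂ] H) (hA : SOTSummable f A) (hPA : ∀ p ∈ P, evalPoly A p = 0) :
    Set.BijOn (fun φ : opSystem f m P →ₗ[ℂ] (H →L[ℂ] H) => φ (opOne f m P))
        (cpMaps f m P A) (pureCone f m A) ∧
    (∀ D ∈ pureCone f m A,
      IsCompatible f m A (defect f A m D) P ∧
      ∃ K : H →L[ℂ] HTensor (Fock ι) (defectSpace (defect f A m D)),
        IsBerezinKernel f m A (defect f A m D) K ∧
        ∃ φ ∈ cpMaps f m P A, φ (opOne f m P) = D ∧
          ∀ χ : opSystem f m P, φ χ = berezinTransform (constrainedKernel f m P K) χ) ∧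
    (∀ D : H →L[ℂ] H, D ∈ pureCone f m A ↔
      ∃ (𝒟 : Type u) (_ : NormedAddCommGroup 𝒟) (_ : InnerProductSpace ℂ 𝒟)
        (_ : CompleteSpace 𝒟) (K : H →L[ℂ] HTensor (f.modelSpace m P) 𝒟),
        D = K.adjoint ∘L K ∧
          ∀ i, K ∘L (A i).adjoint = tensorId (f.model m P i).adjoint 𝒟 ∘L K) ∧
    (∀ (D : H →L[ℂ] H) (𝒟 : Type*) [NormedAddCommGroup 𝒟] [InnerProductSpace ℂ 𝒟]
        [CompleteSpace 𝒟] (K : H →L[ℂ] HTensor (f.modelSpace m P) 𝒟),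
        D = K.adjoint ∘L K →
          (∀ i, K ∘L (A i).adjoint = tensorId (f.model m P i).adjoint 𝒟 ∘L K) →
          D ∈ pureCone f m A) := by
  have hF := hA.formBounded
  have hform : ∀ D ∈ pureCone f m A,
      IsForm A (sqrtInto (defect f A m D)) (f.weight m) D := fun D hD =>
    isForm_of_mem_pureCone hm hF hD (norm_sq_sqrtInto (hD.1 m hm le_rfl))
  have hii : ∀ D ∈ pureCone f m A,
      IsCompatible f m A (defect f A m D) P ∧
      ∃ K : H →L[ℂ] HTensor (Fock ι) (defectSpace (defect f A m D)),
        IsBerezinKernel f m A (defect f A m D) K ∧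
        ∃ φ ∈ cpMaps f m P A, φ (opOne f m P) = D ∧
          ∀ χ : opSystem f m P, φ χ = berezinTransform (constrainedKernel f m P K) χ := by
    intro D hD
    obtain ⟨K, hK⟩ := exists_isBerezinKernel (hform D hD)
    have hKD := (hK.constrained_adjoint_comp_self hPA).trans (hK.adjoint_comp_self (hform D hD))
    have hone : berezinMap (constrainedKernel f m P K) (opSystem f m P) (opOne f m P) = D :=
      berezinTransform_one.trans hKD
    refine ⟨isCompatible_of_mem_pureCone hm hA hD hPA, K, hK,
      berezinMap (constrainedKernel f m P K) (opSystem f m P),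
      ⟨berezinMap_isCompletelyPositive _ _, ?_, fun α β => ?_⟩, hone, fun χ => rfl⟩
    · let _ := weakStar (f.modelSpace m P)
      let _ := weakStar H
      exact (continuous_weakStar_berezinTransform (constrainedKernel f m P K)).comp
        continuous_induced_dom
    · refine (berezinTransform_word (hK.constrained_intertwine hPA) α β).trans ?_
      rw [hone, hKD]
  refine ⟨⟨fun φ hφ => cpMaps_mem_pureCone hm hF hφ, fun φ hφ ψ hψ h => ?_, fun D hD => ?_⟩,
    hii, fun D => ⟨fun hD => ?_, ?_⟩, ?_⟩
  · refine opSystem_ext hφ.2.1 hψ.2.1 fun α β => ?_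
    have h' : φ (opOne f m P) = ψ (opOne f m P) := h
    rw [hφ.2.2, hψ.2.2, h']
  · obtain ⟨-, K, -, φ, hφ, hφD, -⟩ := hii D hD
    exact ⟨φ, hφ, hφD⟩
  -- The space `𝒟`, the closure of the range of `R^{1/2}`, lies in the universe of `H`. The converse
  -- holds for `𝒟` in any universe, which is the final conjunct.
  · obtain ⟨K, hK⟩ := exists_isBerezinKernel (hform D hD)
    exact ⟨defectSpace (defect f A m D), inferInstance, inferInstance, inferInstance,
      constrainedKernel f m P K,
      ((hK.constrained_adjoint_comp_self hPA).trans (hK.adjoint_comp_self (hform D hD))).symm,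
      hK.constrained_intertwine hPA⟩
  · rintro ⟨𝒟, _, _, _, K, rfl, hK⟩
    exact mem_pureCone_of_kernel hm hF K hK
  · rintro D 𝒟 _ _ _ K rfl hK
    exact mem_pureCone_of_kernel hm hF K hK
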